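/- Let $3\le d_A\le d_B\le d_C$ and $0\le n\le\lfloor (d_A-3)/2\rfloor$. Let $\{|0\rangle,\dots,|d_X-1\rangle\}$ be the computational basis of $\mathbb C^{d_X}$, $X\in\{A,B,C\}$, put $w_m=e^{2\pi\sqrt{-1}/m}$, $\mathbb Z_m=\{0,\dots,m-1\}$, and, for $0\le t\le n$, $X_t=d_X-2t$ (so $A_t=d_A-2t$, $B_t=d_B-2t$, $C_t=d_C-2t$) and $$|\eta^{(t)}_s\rangle_X=\sum_{u=0}^{X_t-2}w_{X_t-1}^{su}|t+u\rangle_X,\qquad |\xi^{(t)}_s\rangle_X=\sum_{u=0}^{X_t-2}w_{X_t-1}^{su}|t+u+1\rangle_X\qquad(s\in\mathbb Z_{X_t-1}),$$ $$|\beta^{(t)}_s\rangle_X=\sum_{u=0}^{X_t-3}w_{X_t-2}^{su}|t+u+1\rangle_X\qquad(s\in\mathbb Z_{X_t-2}).$$ In $\mathbb C^{d_A}\otimes\mathbb C^{d_B}\otimes\mathbb C^{d_C}$ define \begin{align*} \mathcal A_1^{(t)}&=\{|\xi_i^{(t)}\rangle_A|t\rangle_B|\eta_k^{(t)}\rangle_C:(i,k)\in\mathbb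 Z_{A_t-1}\times\mathbb Z_{C_t-1}\setminus\{(0,0)\}\},\\ \mathcal A_2^{(t)}&=\{|\xi_i^{(t)}\rangle_A|\eta_j^{(t)}\rangle_B|d_C-1-t\rangle_C:(i,j)\in\mathbb Z_{A_t-1}\times\mathbb Z_{B_t-1}\setminus\{(0,0)\}\},\\ \mathcal A_3^{(t)}&=\{|d_A-1-t\rangle_A|\xi_j^{(t)}\rangle_B|\eta_k^{(t)}\rangle_C:(j,k)\in\mathbb Z_{B_t-1}\times\mathbb Z_{C_t-1}\setminus\{(0,0)\}\},\\ \mathcal B_1^{(t)}&=\{|\eta_i^{(t)}\rangle_A|d_B-1-t\rangle_B|\xi_k^{(t)}\rangle_C:(i,k)\in\mathbb Z_{A_t-1}\times\mathbb Z_{C_t-1}\setminus\{(0,0)\}\},\\ \mathcal B_2^{(t)}&=\{|\eta_i^{(t)}\rangle_A|\xi_j^{(t)}\rangle_B|t\rangle_C:(i,j)\in\mathbb Z_{A_t-1}\times\mathbb Z_{B_t-1}\setminus\{(0,0)\}\},\\ \mathcal B_3^{(t)}&=\{|t\rangle_A|\eta_j^{(t)}\rangle_B|\xi_k^{(t)}\rangle_C:(j,k)\in\mathbb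 Z_{B_t-1}\times\mathbb Z_{C_t-1}\setminus\{(0,0)\}\},\\ \mathcal F^{(n)}&=\{|\beta_i^{(n)}\rangle_A|\beta_j^{(n)}\rangle_B|\beta_k^{(n)}\rangle_C:(i,j,k)\in\mathbb Z_{A_n-2}\times\mathbb Z_{B_n-2}\times\mathbb Z_{C_n-2}\setminus\{(0,0,0)\}\},\\ |S\rangle&=\Big(\sum_{i=0}^{d_A-1}|i\rangle\Big)_A\Big(\sum_{j=0}^{d_B-1}|j\rangle\Big)_B\Big(\sum_{k=0}^{d_C-1}|k\rangle\Big)_C, \end{align*} and $\mathcal U_n=\bigcup_{t=0}^n\bigcup_{i=1}^3\big(\mathcal A_i^{(t)}\cup\mathcal B_i^{(t)}\big)\cup\mathcal F^{(n)}\cup\{|S\rangle\}$. Then $\mathcal U_n$ is an unextendible product basis, that is, a set of nonzero, mutually orthogonal (unnormalized) product vectors which does not span the whole space and whose orthogonal complement contains no nonzero product vector. It has exactly $d_Ad_Bd_C-8(n+1)$ elements. It is moreover strongly nonlocal, that is, locally irreducible in each of the bipartitions $A|BC$, $B|CA$, $C|AB$: no state of $\mathcal U_n$ can be eliminated by orthogonality-preserving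 local measurements. Here a local measurement is a finite family of operators $M_k$ on one of the two sides with $\sum_kM_k^\dagger M_k=\mathbb I$; the two sides may perform finitely many of them one after the other, choosing each according to the earlier outcomes; each must leave the postmeasurement states mutually orthogonal for every outcome; and a state is eliminated if some sequence of outcomes annihilates it but does not annihilate all states of the set. -/

import Mathlib

open scoped Kronecker

noncomputable section

/-! ### Bipartite systems: local measurements and local irreducibility -/

/-- The action of a matrix on a state vector of a bipartite system `ℂ^X ⊗ ℂ^Y`, identified with
`EuclideanSpace ℂ (X × Y)` by its computational basis. -/
def actOn {X Y : Type} [Fintype X] [Fintype Y] [DecidableEq X] [DecidableEq Y]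
    (K : Matrix (X × Y) (X × Y) ℂ) (ψ : EuclideanSpace ℂ (X × Y)) : EuclideanSpace ℂ (X × Y) :=
  Matrix.toEuclideanLin K ψ

/-- `L` is a family of measurement operators `M k` of one party (POVM elements `(M k)ᴴ * M k`,
which sum to the identity), extended by the identity on the other party. -/
def IsLocalMeasurement {X Y : Type} [Fintype X] [Fintype Y] [DecidableEq X] [DecidableEq Y]
    {r : ℕ} (L : Fin r → Matrix (X × Y) (X × Y) ℂ) : Prop :=
  (∃ M : Fin r → Matrix X X ℂ, ∑ k, (M k).conjTranspose * M k = 1 ∧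
      ∀ k, L k = M k ⊗ₖ (1 : Matrix Y Y ℂ)) ∨
  (∃ M : Fin r → Matrix Y Y ℂ, ∑ k, (M k).conjTranspose * M k = 1 ∧
      ∀ k, L k = (1 : Matrix X X ℂ) ⊗ₖ M k)

/-- The images under `K` of distinct states of `U` are orthogonal. -/
def KeepsOrthogonal {X Y : Type} [Fintype X] [Fintype Y] [DecidableEq X] [DecidableEq Y]
    (U : Set (EuclideanSpace ℂ (X × Y))) (K : Matrix (X × Y) (X × Y) ℂ) : Prop :=
  U.Pairwise fun ψ φ => inner ℂ (actOn K ψ) (actOn K φ) = 0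

/-- `Reachable U K`: the operator `K` is the accumulated effect of one branch of a finite
adaptive sequence of local measurements by the two parties, each of which keeps the
postmeasurement states of `U` mutually orthogonal for every one of its outcomes. -/
inductive Reachable {X Y : Type} [Fintype X] [Fintype Y] [DecidableEq X] [DecidableEq Y]
    (U : Set (EuclideanSpace ℂ (X × Y))) : Matrix (X × Y) (X × Y) ℂ → Prop
  | start : Reachable U 1
  | measure {K : Matrix (X × Y) (X × Y) ℂ} (hK : Reachable U K) {r : ℕ}
      (L : Fin r → Matrix (X × Y) (X × Y) ℂ) (hL : IsLocalMeasurement L)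
      (hU : ∀ k, KeepsOrthogonal U (L k * K)) (k : Fin r) : Reachable U (L k * K)

/-- No state of `U` can be eliminated by orthogonality-preserving local measurements: along every
branch that can occur for some state of `U`, every state of `U` survives. -/
def LocallyIrreducible {X Y : Type} [Fintype X] [Fintype Y] [DecidableEq X] [DecidableEq Y]
    (U : Set (EuclideanSpace ℂ (X × Y))) : Prop :=
  ∀ K, Reachable U K → (∃ φ ∈ U, actOn K φ ≠ 0) → ∀ ψ ∈ U, actOn K ψ ≠ 0

/-! ### Tripartite systems -/

/-- The system `ℂ^a ⊗ ℂ^b ⊗ ℂ^c`, in coordinates with respect to the computational basis. -/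
abbrev Tri (a b c : ℕ) : Type := EuclideanSpace ℂ (Fin a × Fin b × Fin c)

/-- The vector `x ⊗ y ⊗ z`. -/
def triProd {a b c : ℕ} (x : EuclideanSpace ℂ (Fin a)) (y : EuclideanSpace ℂ (Fin b))
    (z : EuclideanSpace ℂ (Fin c)) : Tri a b c :=
  WithLp.toLp 2 fun p => x p.1 * y p.2.1 * z p.2.2

/-- States are nonzero vectors, not necessarily normalized. -/
def IsProductState {a b c : ℕ} (ψ : Tri a b c) : Prop :=
  ψ ≠ 0 ∧ ∃ x y z, ψ = triProd x y z

/-- Orthogonal product set. -/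
def IsOPS {a b c : ℕ} (U : Set (Tri a b c)) : Prop :=
  (∀ ψ ∈ U, IsProductState ψ) ∧ U.Pairwise fun ψ φ => inner ℂ ψ φ = 0

/-- Unextendible product basis: an incomplete orthogonal product set whose complementary subspace
contains no product state. -/
def IsUPB {a b c : ℕ} (U : Set (Tri a b c)) : Prop :=
  IsOPS U ∧ Submodule.span ℂ U ≠ ⊤ ∧ ∀ ψ ∈ (Submodule.span ℂ U)ᗮ, ¬ IsProductState ψ

/-- Regrouping `(i, j, k) ↦ (j, (k, i))` for the bipartition `B|CA`. -/
def groupB (a b c : ℕ) : Fin a × Fin b × Fin c ≃ Fin b × (Fin c × Fin a) where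
  toFun p := (p.2.1, (p.2.2, p.1))
  invFun q := (q.2.2, q.1, q.2.1)
  left_inv _ := rfl
  right_inv _ := rfl

/-- Regrouping `(i, j, k) ↦ (k, (i, j))` for the bipartition `C|AB`. -/
def groupC (a b c : ℕ) : Fin a × Fin b × Fin c ≃ Fin c × (Fin a × Fin b) where
  toFun p := (p.2.2, (p.1, p.2.1))
  invFun q := (q.2.1, q.2.2, q.1)
  left_inv _ := rfl
  right_inv _ := rfl

/-- Strong nonlocality of an orthogonal product set: local irreducibility in each of the
bipartitions `A|BC`, `B|CA` and `C|AB`. -/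
def StronglyNonlocal {a b c : ℕ} (U : Set (Tri a b c)) : Prop :=
  IsOPS U ∧
  LocallyIrreducible U ∧
  LocallyIrreducible (LinearIsometryEquiv.piLpCongrLeft 2 ℂ ℂ (groupB a b c) '' U) ∧
  LocallyIrreducible (LinearIsometryEquiv.piLpCongrLeft 2 ℂ ℂ (groupC a b c) '' U)

/-! ### The construction -/

/-- The primitive root of unity `exp (2πi / m)`. -/
def w (m : ℕ) : ℂ := Complex.exp (2 * Real.pi * Complex.I / m)

/-- The computational basis vector `|t⟩` of `ℂ^d`, for `t < d`. -/
def ket (d t : ℕ) : EuclideanSpace ℂ (Fin d) :=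
  WithLp.toLp 2 fun x => if (x : ℕ) = t then 1 else 0

/-- `|η_s^{(n)}⟩ = ∑_{u=0}^{d-2n-2} w_{d-2n-1}^{su} |n+u⟩`. -/
def eta (d n s : ℕ) : EuclideanSpace ℂ (Fin d) :=
  ∑ u ∈ Finset.range (d - 2 * n - 1), w (d - 2 * n - 1) ^ (s * u) • ket d (n + u)

/-- `|ξ_s^{(n)}⟩ = ∑_{u=0}^{d-2n-2} w_{d-2n-1}^{su} |n+u+1⟩`. -/
def xi (d n s : ℕ) : EuclideanSpace ℂ (Fin d) :=
  ∑ u ∈ Finset.range (d - 2 * n - 1), w (d - 2 * n - 1) ^ (s * u) • ket d (n + u + 1)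

/-- `|β_s^{(n)}⟩ = ∑_{u=0}^{d-2n-3} w_{d-2n-2}^{su} |n+u+1⟩`. -/
def beta (d n s : ℕ) : EuclideanSpace ℂ (Fin d) :=
  ∑ u ∈ Finset.range (d - 2 * n - 2), w (d - 2 * n - 2) ^ (s * u) • ket d (n + u + 1)

/-- The index set `ℤ_p × ℤ_q ∖ {(0,0)}`. -/
def idx (p q : ℕ) : Set (ℕ × ℕ) := {v | v.1 < p ∧ v.2 < q ∧ v ≠ (0, 0)}

def setA1 (a b c n : ℕ) : Set (Tri a b c) :=
  (fun v : ℕ × ℕ => triProd (xi a n v.1) (ket b n) (eta c n v.2)) ''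
    idx (a - 2 * n - 1) (c - 2 * n - 1)

def setA2 (a b c n : ℕ) : Set (Tri a b c) :=
  (fun v : ℕ × ℕ => triProd (xi a n v.1) (eta b n v.2) (ket c (c - 1 - n))) ''
    idx (a - 2 * n - 1) (b - 2 * n - 1)

def setA3 (a b c n : ℕ) : Set (Tri a b c) :=
  (fun v : ℕ × ℕ => triProd (ket a (a - 1 - n)) (xi b n v.1) (eta c n v.2)) ''
    idx (b - 2 * n - 1) (c - 2 * n - 1)

def setB1 (a b c n : ℕ) : Set (Tri a b c) :=
  (fun v : ℕ × ℕ => triProd (eta a n v.1) (ket b (b - 1 - n)) (xi c n v.2)) ''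
    idx (a - 2 * n - 1) (c - 2 * n - 1)

def setB2 (a b c n : ℕ) : Set (Tri a b c) :=
  (fun v : ℕ × ℕ => triProd (eta a n v.1) (xi b n v.2) (ket c n)) ''
    idx (a - 2 * n - 1) (b - 2 * n - 1)

def setB3 (a b c n : ℕ) : Set (Tri a b c) :=
  (fun v : ℕ × ℕ => triProd (ket a n) (eta b n v.1) (xi c n v.2)) ''
    idx (b - 2 * n - 1) (c - 2 * n - 1)

def setF (a b c n : ℕ) : Set (Tri a b c) :=
  (fun v : ℕ × ℕ × ℕ => triProd (beta a n v.1) (beta b n v.2.1) (beta c n v.2.2)) ''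
    {v | v.1 < a - 2 * n - 2 ∧ v.2.1 < b - 2 * n - 2 ∧ v.2.2 < c - 2 * n - 2 ∧ v ≠ (0, 0, 0)}

/-- The stopper state. -/
def stopper (a b c : ℕ) : Tri a b c :=
  triProd (∑ i ∈ Finset.range a, ket a i) (∑ j ∈ Finset.range b, ket b j)
    (∑ k ∈ Finset.range c, ket c k)

/-- The set `U_n`. -/
def setU (a b c n : ℕ) : Set (Tri a b c) :=
  (⋃ t ∈ Finset.range (n + 1),
    setA1 a b c t ∪ setA2 a b c t ∪ setA3 a b c t ∪
      (setB1 a b c t ∪ setB2 a b c t ∪ setB3 a b c t)) ∪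
  setF a b c n ∪ {stopper a b c}

end

/-! Everything is geometry of boxes in the grid of basis labels. Each of the families is a discrete
Fourier basis of the functions on a box, with the constant function left out. A shell contributes
six boxes of thickness one arranged like a pinwheel. They are disjoint and cover the surface of a
cuboid except for two opposite corners. The core is one more box. Hence distinct states are
orthogonal. Each of the 6(n+1)+1 boxes loses one state, 2(n+1) corners are uncovered and the stopper
adds one state, which leaves 8(n+1) fewer states than the dimension.

A vector orthogonal to all states is constant on every box and has zero total sum. If it is a
product, constancy on the six boxes of the outermost shell, together with the zero sum, forces each
factor to vanish at both of its ends (`ShellConst.low_eq_zero`). This peels the shells off one by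
one. On the core the factors are then nonzero constants, so the total sum cannot vanish.

For strong nonlocality it suffices that a Hermitian `E` on two parties, with 1 ⊗ E vanishing between
distinct states, is a multiple of the identity (`VanishesOffDiag.trivial`). The outermost shell and
the stopper already give this. Two boxes whose first-party factors overlap yield a vanishing block
of `E`, or a constancy relation when one of them is thin in the first direction. The stopper makes
all column sums equal. On the two wide faces, `E` with a small correction is diagonal in the Fourier
basis, hence invariant under simultaneous cyclic shifts, and every off-diagonal entry can be shifted
to a known zero (`FourierOn.offDiag_eq_zero`). Triviality for one party follows by padding its
operator with the identity, and the other bipartitions follow by cyclic symmetry. Every operator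
reachable by measurements then scales all norms by one common factor, so it kills all states or
none. -/

noncomputable section

open scoped ComplexConjugate

/-! ### Fourier families on boxes -/

/-- The functions `φ s`, `s ∈ I`, form an orthogonal basis of the functions supported on `D`,
they all have squared norm `N`, and `φ 0` is the indicator function of `D`. -/
structure FourierOn {T S : Type} [Fintype T] [DecidableEq T] [Zero S] [DecidableEq S]
    (D : Set T) (I : Finset S) (φ : S → T → ℂ) (N : ℕ) : Prop where
  zero_mem : 0 ∈ I
  pos : N ≠ 0
  supp : ∀ s p, p ∉ D → φ s p = 0
  zero_apply : ∀ p ∈ D, φ 0 p = 1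
  orth : ∀ s ∈ I, ∀ s' ∈ I, ∑ p, conj (φ s p) * φ s' p = if s = s' then (N : ℂ) else 0
  recon : ∀ p ∈ D, ∀ q ∈ D, ∑ s ∈ I, φ s p * conj (φ s q) = if p = q then (N : ℂ) else 0

namespace FourierOn

section
variable {T S : Type} [Fintype T] [DecidableEq T] [Zero S] [DecidableEq S]
  {D : Set T} {I : Finset S} {φ : S → T → ℂ} {N : ℕ}

theorem sum_eq (h : FourierOn D I φ N) {s : S} (hs : s ∈ I) :
    ∑ p, φ s p = if s = 0 then (N : ℂ) else 0 := by
  have := h.orth 0 h.zero_mem s hs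
  rw [show (if s = 0 then (N : ℂ) else 0) = if 0 = s then (N : ℂ) else 0 by simp [eq_comm], ← this]
  refine Finset.sum_congr rfl fun p _ => ?_
  by_cases hp : p ∈ D
  · simp [h.zero_apply p hp]
  · simp [h.supp _ p hp]

theorem eq_zero (h : FourierOn D I φ N) (g : T → ℂ)
    (hg : ∀ s ∈ I, ∑ p, g p * φ s p = 0) {p : T} (hp : p ∈ D) : g p = 0 := by
  have h1 : ∑ s ∈ I, (∑ q, g q * φ s q) * conj (φ s p) = 0 :=
    Finset.sum_eq_zero fun s hs => by rw [hg s hs, zero_mul]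
  simp_rw [Finset.sum_mul] at h1
  rw [Finset.sum_comm] at h1
  have h2 : ∀ q, ∑ s ∈ I, g q * φ s q * conj (φ s p) = if q = p then g q * N else 0 := by
    intro q
    by_cases hq : q ∈ D
    · simp_rw [mul_assoc]
      rw [← Finset.mul_sum, h.recon q hq p hp]
      split_ifs <;> simp
    · rw [if_neg (by rintro rfl; exact hq hp)]
      exact Finset.sum_eq_zero fun s _ => by rw [h.supp s q hq]; ring
  simp_rw [h2] at h1
  simpa [h.pos] using h1

/-- Subtracting the mean of `g` over `D` makes it orthogonal to `φ 0` as well, without affecting the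
other conditions. The difference then vanishes on `D` by `eq_zero`. -/
theorem eq_of_mem (h : FourierOn D I φ N) (g : T → ℂ)
    (hg : ∀ s ∈ I, s ≠ 0 → ∑ p, g p * φ s p = 0) {p q : T} (hp : p ∈ D) (hq : q ∈ D) :
    g p = g q := by
  have hN : (N : ℂ) ≠ 0 := by exact_mod_cast h.pos
  have key : ∀ p ∈ D, g p - (∑ p, g p * φ 0 p) / N = 0 := by
    intro p hp
    refine h.eq_zero (fun p => g p - (∑ p, g p * φ 0 p) / N) (fun s hs => ?_) hp
    simp_rw [sub_mul]
    rw [Finset.sum_sub_distrib, ← Finset.mul_sum, h.sum_eq hs]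
    by_cases h0 : s = 0
    · subst h0; simp [hN]
    · rw [hg s hs h0]; simp [h0]
  rw [sub_eq_zero.1 (key p hp), sub_eq_zero.1 (key q hq)]

theorem star_eq_of_mem (h : FourierOn D I φ N) (g : T → ℂ)
    (hg : ∀ s ∈ I, s ≠ 0 → ∑ p, conj (φ s p) * g p = 0) {p q : T} (hp : p ∈ D) (hq : q ∈ D) :
    g p = g q := by
  have := h.eq_of_mem (fun p => conj (g p)) (fun s hs h0 => by
    have := congrArg conj (hg s hs h0)
    simpa [mul_comm] using this) hp hq
  exact star_injective this

theorem star_eq_zero (h : FourierOn D I φ N) (g : T → ℂ)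
    (hg : ∀ s ∈ I, ∑ p, conj (φ s p) * g p = 0) {p : T} (hp : p ∈ D) : g p = 0 := by
  have := h.eq_zero (fun p => conj (g p)) (fun s hs => by
    have := congrArg conj (hg s hs)
    simpa [mul_comm] using this) hp
  simpa using this

/-- A sesquilinear form that is diagonal in the Fourier family depends only on the correlations
`φ s p * conj (φ s q)`. -/
theorem eq_of_diagonal (h : FourierOn D I φ N) (E : T → T → ℂ)
    (hE : ∀ s ∈ I, ∀ s' ∈ I, s ≠ s' → ∑ p, ∑ q, conj (φ s p) * E p q * φ s' q = 0)
    {p q p' q' : T} (hp : p ∈ D) (hq : q ∈ D) (hp' : p' ∈ D) (hq' : q' ∈ D)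
    (hc : ∀ s ∈ I, φ s p * conj (φ s q) = φ s p' * conj (φ s q')) : E p q = E p' q' := by
  have hN : (N : ℂ) ≠ 0 := by exact_mod_cast h.pos
  -- `F / N²` is the spectral expansion of `E` on `D × D`, whose terms involve `p, q` only through
  -- the correlations. The remainder `E * N² - F` is orthogonal to the Fourier family in both
  -- variables, so it vanishes there.
  let F : T → T → ℂ := fun p q => ∑ s ∈ I,
    (∑ u, ∑ v, conj (φ s u) * E u v * φ s v) * (φ s p * conj (φ s q))
  have key : ∀ p ∈ D, ∀ q ∈ D, E p q * (N * N) - F p q = 0 := by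
    intro p hp q hq
    refine h.star_eq_zero (fun p => E p q * (N * N) - F p q) (fun s hs => ?_) hp
    refine h.eq_zero (fun q => ∑ p, conj (φ s p) * (E p q * (N * N) - F p q)) (fun s' hs' => ?_) hq
    have e1 : ∑ q, (∑ p, conj (φ s p) * (E p q * (N * N) - F p q)) * φ s' q
        = (∑ u, ∑ v, conj (φ s u) * E u v * φ s' v) * (N * N)
          - ∑ r ∈ I, (∑ u, ∑ v, conj (φ r u) * E u v * φ r v) *
            ((∑ p, conj (φ s p) * φ r p) * (∑ q, conj (φ r q) * φ s' q)) := by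
      simp_rw [mul_sub, Finset.sum_sub_distrib, sub_mul, Finset.sum_sub_distrib]
      congr 1
      · rw [Finset.sum_comm (s := Finset.univ (α := T)) (t := Finset.univ (α := T))
          (f := fun u v => conj (φ s u) * E u v * φ s' v), Finset.sum_mul]
        refine Finset.sum_congr rfl fun v _ => ?_
        rw [Finset.sum_mul, Finset.sum_mul]
        exact Finset.sum_congr rfl fun u _ => by ring
      · simp only [F, Finset.mul_sum, Finset.sum_mul]
        simp_rw [Finset.sum_comm (t := I)]
        refine Finset.sum_congr rfl fun r _ => ?_
        refine Finset.sum_congr rfl fun v _ => ?_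
        refine Finset.sum_congr rfl fun u _ => ?_
        refine Finset.sum_congr rfl fun v' _ => ?_
        refine Finset.sum_congr rfl fun u' _ => ?_
        ring
    rw [e1]
    by_cases hss : s = s'
    · subst hss
      rw [Finset.sum_eq_single s]
      · rw [h.orth s hs s hs]; simp
      · intro r hr hne
        rw [h.orth s hs r hr, if_neg hne.symm]; ring
      · exact fun hh => absurd hs hh
    · rw [hE s hs s' hs' hss, zero_mul, zero_sub, neg_eq_zero]
      refine Finset.sum_eq_zero fun r hr => ?_
      rw [h.orth s hs r hr, h.orth r hr s' hs']
      by_cases h1 : s = r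
      · subst h1; simp [hss]
      · simp [h1]
  have hF : F p q = F p' q' := Finset.sum_congr rfl fun s hs => by rw [hc s hs]
  have h1 := sub_eq_zero.1 (key p hp q hq)
  have h2 := sub_eq_zero.1 (key p' hp' q' hq')
  exact mul_right_cancel₀ (mul_ne_zero hN hN) (h1.trans (hF.trans h2.symm))

end

theorem prod {T S T' S' : Type} [Fintype T] [DecidableEq T] [Zero S] [DecidableEq S]
    [Fintype T'] [DecidableEq T'] [Zero S'] [DecidableEq S']
    {D : Set T} {I : Finset S} {φ : S → T → ℂ} {N : ℕ}
    {D' : Set T'} {I' : Finset S'} {φ' : S' → T' → ℂ} {N' : ℕ}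
    (h : FourierOn D I φ N) (h' : FourierOn D' I' φ' N') :
    FourierOn (D ×ˢ D') (I ×ˢ I') (fun s p => φ s.1 p.1 * φ' s.2 p.2) (N * N') where
  zero_mem := Finset.mem_product.2 ⟨h.zero_mem, h'.zero_mem⟩
  pos := mul_ne_zero h.pos h'.pos
  supp s p hp := by
    rw [Set.mem_prod, not_and_or] at hp
    rcases hp with hp | hp
    · rw [h.supp _ _ hp, zero_mul]
    · rw [h'.supp _ _ hp, mul_zero]
  zero_apply p hp := by
    change φ 0 p.1 * φ' 0 p.2 = 1
    rw [h.zero_apply _ hp.1, h'.zero_apply _ hp.2, one_mul]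
  orth s hs s' hs' := by
    rw [Finset.mem_product] at hs hs'
    have : ∑ p : T × T', conj (φ s.1 p.1 * φ' s.2 p.2) * (φ s'.1 p.1 * φ' s'.2 p.2)
        = (∑ p, conj (φ s.1 p) * φ s'.1 p) * ∑ p, conj (φ' s.2 p) * φ' s'.2 p := by
      rw [Fintype.sum_prod_type, Finset.sum_mul_sum]
      refine Finset.sum_congr rfl fun _ _ => Finset.sum_congr rfl fun _ _ => ?_
      rw [map_mul]; ring
    rw [this, h.orth _ hs.1 _ hs'.1, h'.orth _ hs.2 _ hs'.2]
    by_cases h1 : s.1 = s'.1 <;> by_cases h2 : s.2 = s'.2 <;> simp [Prod.ext_iff, h1, h2]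
  recon p hp q hq := by
    have : ∑ s ∈ I ×ˢ I', φ s.1 p.1 * φ' s.2 p.2 * conj (φ s.1 q.1 * φ' s.2 q.2)
        = (∑ s ∈ I, φ s p.1 * conj (φ s q.1)) * ∑ s ∈ I', φ' s p.2 * conj (φ' s q.2) := by
      rw [Finset.sum_product, Finset.sum_mul_sum]
      refine Finset.sum_congr rfl fun _ _ => Finset.sum_congr rfl fun _ _ => ?_
      rw [map_mul]; ring
    rw [this, h.recon _ hp.1 _ hq.1, h'.recon _ hp.2 _ hq.2]
    by_cases h1 : p.1 = q.1 <;> by_cases h2 : p.2 = q.2 <;> simp [Prod.ext_iff, h1, h2]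

end FourierOn

/-! ### Roots of unity and Fourier vectors on an interval -/

theorem w_isPrimitiveRoot {m : ℕ} (hm : m ≠ 0) : IsPrimitiveRoot (w m) m :=
  Complex.isPrimitiveRoot_exp m hm

theorem w_mul_conj {m : ℕ} (hm : m ≠ 0) : w m * conj (w m) = 1 := by
  rw [Complex.mul_conj, Complex.normSq_eq_norm_sq, (w_isPrimitiveRoot hm).norm'_eq_one hm]
  simp

theorem w_pow_sum {m u v : ℕ} (hu : u < m) (hv : v < m) :
    ∑ s ∈ Finset.range m, w m ^ (s * u) * conj (w m ^ (s * v)) = if u = v then (m : ℂ) else 0 := by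
  have hm : m ≠ 0 := by omega
  have hw := w_mul_conj hm
  have hz : ∀ s, w m ^ (s * u) * conj (w m ^ (s * v)) = (w m ^ u * conj (w m) ^ v) ^ s := by
    intro s; rw [map_pow, mul_comm s u, mul_comm s v, pow_mul, pow_mul, mul_pow]
  simp_rw [hz]
  split_ifs with h
  · subst h
    simp [← mul_pow, hw]
  · have h1 : w m ^ u * conj (w m) ^ v ≠ 1 := by
      intro h1
      apply h
      refine (w_isPrimitiveRoot hm).pow_inj hu hv ?_
      calc w m ^ u = w m ^ u * (w m * conj (w m)) ^ v := by rw [hw, one_pow, mul_one]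
        _ = (w m ^ u * conj (w m) ^ v) * w m ^ v := by rw [mul_pow]; ring
        _ = w m ^ v := by rw [h1, one_mul]
    have h2 : (w m ^ u * conj (w m) ^ v) ^ m = 1 := by
      rw [mul_pow, ← pow_mul, ← pow_mul, mul_comm u, mul_comm v, pow_mul, pow_mul, ← map_pow,
        (w_isPrimitiveRoot hm).pow_eq_one]
      simp
    have h3 := mul_neg_geom_sum (w m ^ u * conj (w m) ^ v) m
    rw [h2, sub_self] at h3
    exact (mul_eq_zero.1 h3).resolve_left (sub_ne_zero.2 (Ne.symm h1))

/-- The Fourier vector `∑_{u < m} w_m^{su} |x + u⟩` on the interval `[x, x + m)`. -/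
def four (d x m s : ℕ) : EuclideanSpace ℂ (Fin d) :=
  ∑ u ∈ Finset.range m, w m ^ (s * u) • ket d (x + u)

theorem ket_apply (d t : ℕ) (i : Fin d) : ket d t i = if (i : ℕ) = t then 1 else 0 := rfl

theorem four_apply (d x m s : ℕ) (i : Fin d) :
    four d x m s i = if x ≤ i ∧ (i : ℕ) < x + m then w m ^ (s * (i - x)) else 0 := by
  simp only [four, WithLp.ofLp_sum, WithLp.ofLp_smul, Finset.sum_apply, Pi.smul_apply,
    smul_eq_mul, ket_apply, mul_ite, mul_one, mul_zero]
  split_ifs with h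
  · rw [Finset.sum_eq_single ((i : ℕ) - x)]
    · rw [if_pos (by omega)]
    · intro u _ hu; rw [if_neg (by omega)]
    · intro hh; rw [Finset.mem_range] at hh; omega
  · refine Finset.sum_eq_zero fun u hu => ?_
    rw [Finset.mem_range] at hu
    rw [if_neg (by omega)]

theorem ket_eq_four (d t : ℕ) : ket d t = four d t 1 0 := by simp [four]

/-- The indices of the interval `[x, x + m)`. -/
def ival (d x m : ℕ) : Set (Fin d) := {i | x ≤ i ∧ (i : ℕ) < x + m}

theorem sum_ival (d x m : ℕ) (hd : x + m ≤ d) (f : Fin d → ℂ) (g : ℕ → ℂ)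
    (hf : ∀ i, f i = if x ≤ i ∧ (i : ℕ) < x + m then g (i - x) else 0) :
    ∑ i, f i = ∑ u ∈ Finset.range m, g u := by
  simp_rw [hf]
  rw [← Finset.sum_filter]
  refine Finset.sum_bij' (fun i _ => (i : ℕ) - x)
    (fun u hu => ⟨x + u, by rw [Finset.mem_range] at hu; omega⟩) ?_ ?_ ?_ ?_ ?_
  · intro i hi; simp at hi ⊢; omega
  · intro u hu; simp at hu ⊢; omega
  · intro i hi; simp at hi; ext; simp; omega
  · intro u hu; simp
  · intro i hi; rfl

/-- The Fourier matrix `w m ^ (s * u)` is symmetric, so `w_pow_sum` serves both for orthogonality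
(summing over `u`) and for completeness (summing over `s`). -/
theorem fourierOn_four {d x m : ℕ} (hm : m ≠ 0) (hd : x + m ≤ d) :
    FourierOn (ival d x m) (Finset.range m) (fun s i => four d x m s i) m where
  zero_mem := by simpa using Nat.pos_of_ne_zero hm
  pos := hm
  supp s p hp := by exact (four_apply ..).trans (if_neg hp)
  zero_apply p hp := by exact (four_apply ..).trans ((if_pos hp).trans (by simp))
  orth s hs s' hs' := by
    rw [Finset.mem_range] at hs hs'
    rw [sum_ival d x m hd _ fun u => conj (w m ^ (s * u)) * w m ^ (s' * u)]
    · rw [show (if s = s' then (m : ℂ) else 0) = if s' = s then (m : ℂ) else 0 by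
        simp [eq_comm], ← w_pow_sum hs' hs]
      exact Finset.sum_congr rfl fun u _ => by rw [mul_comm, mul_comm s, mul_comm s']
    · intro i
      simp only [four_apply]
      split_ifs <;> simp
  recon p hp q hq := by
    have hp' : (p : ℕ) - x < m := by have := hp.1; have := hp.2; omega
    have hq' : (q : ℕ) - x < m := by have := hq.1; have := hq.2; omega
    have hp0 : x ≤ p ∧ (p : ℕ) < x + m := hp
    have hq0 : x ≤ q ∧ (q : ℕ) < x + m := hq
    simp only [four_apply, if_pos hp0, if_pos hq0]
    rw [w_pow_sum hp' hq']
    have : (p : ℕ) - x = q - x ↔ p = q := by rw [Fin.ext_iff]; omega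
    simp [this]

/-- Cyclic shift in an interval: for given `i, j, i'` there is `j'` with the same correlations. -/
theorem exists_shift {d x m : ℕ} (hd : x + m ≤ d) {i j i' : Fin d} (hi : i ∈ ival d x m)
    (hj : j ∈ ival d x m) (hi' : i' ∈ ival d x m) :
    ∃ j' ∈ ival d x m, (i = j ↔ i' = j') ∧ ∀ s,
      four d x m s i * conj (four d x m s j) = four d x m s i' * conj (four d x m s j') := by
  simp only [ival, Set.mem_ofPred_eq] at hi hj hi'
  have hm : m ≠ 0 := by omega
  -- The correlation of `i, j` depends only on `i - j` modulo `m`, so `j'` has offset `i' + j - i`.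
  -- The summand `m` keeps the natural-number subtraction from truncating.
  obtain ⟨v, hv, hmod⟩ : ∃ v < m, (i - x) + v ≡ (i' - x) + (j - x) [MOD m] := by
    refine ⟨((i' - x) + (j - x) + (m - (i - x))) % m, Nat.mod_lt _ (by omega), ?_⟩
    refine (Nat.ModEq.add_left _ (Nat.mod_modEq _ _)).trans ?_
    rw [show (i - x) + ((i' - x) + (j - x) + (m - (i - x))) = (i' - x) + (j - x) + m by omega]
    simp [Nat.ModEq]
  have hj' : x ≤ x + v ∧ x + v < x + m := by omega
  refine ⟨⟨x + v, by omega⟩, hj', ?_, fun s => ?_⟩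
  · rw [Fin.ext_iff, Fin.ext_iff]
    constructor
    · intro h
      rw [h, add_comm] at hmod
      have := (Nat.ModEq.add_right_cancel' _ hmod).eq_of_lt_of_lt hv (by omega)
      simp only; omega
    · intro h
      simp only at h
      rw [show (i' : ℕ) - x = v by omega, add_comm] at hmod
      have := (Nat.ModEq.add_left_cancel' _ hmod).eq_of_lt_of_lt (by omega) (by omega)
      omega
  · have hw := w_mul_conj hm
    have hwc : ∀ k, w m ^ k * conj (w m) ^ k = 1 := fun k => by rw [← mul_pow, hw, one_pow]
    have e : w m ^ (s * (i - x)) * w m ^ (s * v)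
        = w m ^ (s * (i' - x)) * w m ^ (s * (j - x)) := by
      rw [← pow_add, ← pow_add, ← mul_add, ← mul_add]
      have h1 := (w_isPrimitiveRoot hm).pow_eq_one
      rw [pow_eq_pow_mod _ h1, hmod.mul_left s, ← pow_eq_pow_mod _ h1]
    simp only [four_apply, if_pos hi, if_pos hj, if_pos hi', if_pos hj', map_pow,
      Nat.add_sub_cancel_left]
    calc w m ^ (s * (i - x)) * conj (w m) ^ (s * (j - x))
        = (w m ^ (s * (i - x)) * w m ^ (s * v)) * conj (w m) ^ (s * v)
            * conj (w m) ^ (s * (j - x)) := by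
          linear_combination (-(w m ^ (s * (i - x)) * conj (w m) ^ (s * (j - x)))) * hwc (s * v)
      _ = _ := by
          rw [e]
          linear_combination (w m ^ (s * (i' - x)) * conj (w m) ^ (s * v)) * hwc (s * (j - x))

/-! ### The decomposition of the cube into boxes -/

/-- The box `[x, x + p) × [y, y + q) × [z, z + r)`. -/
structure Box where
  x : ℕ
  p : ℕ
  y : ℕ
  q : ℕ
  z : ℕ
  r : ℕ

/-- The box is nonempty and contained in `[0, a) × [0, b) × [0, c)`. -/
structure Box.Valid (B : Box) (a b c : ℕ) : Prop where
  p_ne : B.p ≠ 0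
  q_ne : B.q ≠ 0
  r_ne : B.r ≠ 0
  x_le : B.x + B.p ≤ a
  y_le : B.y + B.q ≤ b
  z_le : B.z + B.r ≤ c

def Box.dom (B : Box) (a b c : ℕ) : Set (Fin a × Fin b × Fin c) :=
  ival a B.x B.p ×ˢ (ival b B.y B.q ×ˢ ival c B.z B.r)

def Box.idx (B : Box) : Finset (ℕ × ℕ × ℕ) :=
  Finset.range B.p ×ˢ (Finset.range B.q ×ˢ Finset.range B.r)

def Box.vec (B : Box) (a b c : ℕ) (s : ℕ × ℕ × ℕ) : Tri a b c :=
  triProd (four a B.x B.p s.1) (four b B.y B.q s.2.1) (four c B.z B.r s.2.2)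

/-- The order is A₁, A₂, A₃, B₁, B₂, B₃. A basis ket counts as an interval of length 1. The corners
(t, t, t) and (a-1-t, b-1-t, c-1-t) belong to none of the six. -/
def shellBox (a b c t : ℕ) : Fin 6 → Box
  | 0 => ⟨t + 1, a - 2 * t - 1, t, 1, t, c - 2 * t - 1⟩
  | 1 => ⟨t + 1, a - 2 * t - 1, t, b - 2 * t - 1, c - 1 - t, 1⟩
  | 2 => ⟨a - 1 - t, 1, t + 1, b - 2 * t - 1, t, c - 2 * t - 1⟩
  | 3 => ⟨t, a - 2 * t - 1, b - 1 - t, 1, t + 1, c - 2 * t - 1⟩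
  | 4 => ⟨t, a - 2 * t - 1, t + 1, b - 2 * t - 1, t, 1⟩
  | 5 => ⟨t, 1, t, b - 2 * t - 1, t + 1, c - 2 * t - 1⟩

def coreBox (a b c n : ℕ) : Box :=
  ⟨n + 1, a - 2 * n - 2, n + 1, b - 2 * n - 2, n + 1, c - 2 * n - 2⟩

/-- All the boxes of the construction: the six boxes of each shell, and the core. -/
def box (a b c n : ℕ) : Option (Fin (n + 1) × Fin 6) → Box
  | some (t, e) => shellBox a b c t e
  | none => coreBox a b c n

theorem triProd_apply {a b c : ℕ} (x : EuclideanSpace ℂ (Fin a)) (y : EuclideanSpace ℂ (Fin b))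
    (z : EuclideanSpace ℂ (Fin c)) (P : Fin a × Fin b × Fin c) :
    triProd x y z P = x P.1 * y P.2.1 * z P.2.2 := rfl

theorem Box.vec_apply (B : Box) (a b c : ℕ) (s : ℕ × ℕ × ℕ) (P : Fin a × Fin b × Fin c) :
    B.vec a b c s P = four a B.x B.p s.1 P.1 *
      (four b B.y B.q s.2.1 P.2.1 * four c B.z B.r s.2.2 P.2.2) := by
  rw [Box.vec, triProd_apply, mul_assoc]

theorem Box.Valid.fourierOn {B : Box} {a b c : ℕ} (h : B.Valid a b c) :
    FourierOn (B.dom a b c) B.idx (fun s P => B.vec a b c s P) (B.p * (B.q * B.r)) := by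
  simp_rw [Box.vec_apply]
  exact (fourierOn_four h.p_ne h.x_le).prod
    ((fourierOn_four h.q_ne h.y_le).prod (fourierOn_four h.r_ne h.z_le))

theorem box_valid {a b c n : ℕ} (ha : 2 * n + 3 ≤ a) (hb : 2 * n + 3 ≤ b) (hc : 2 * n + 3 ≤ c)
    (k : Option (Fin (n + 1) × Fin 6)) : (box a b c n k).Valid a b c := by
  rcases k with _ | ⟨t, e⟩
  · constructor <;> simp only [box, coreBox] <;> omega
  · have := t.2
    fin_cases e <;> constructor <;> simp only [box, shellBox] <;> omega

theorem Box.mem_dom {B : Box} {a b c : ℕ} {P : Fin a × Fin b × Fin c} :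
    P ∈ B.dom a b c ↔ (B.x ≤ P.1 ∧ (P.1 : ℕ) < B.x + B.p) ∧
      (B.y ≤ P.2.1 ∧ (P.2.1 : ℕ) < B.y + B.q) ∧ (B.z ≤ P.2.2 ∧ (P.2.2 : ℕ) < B.z + B.r) :=
  Iff.rfl

theorem shellBox_eq_of_mem {a b c t t' : ℕ} {e e' : Fin 6} (ha : 2 * t' + 3 ≤ a)
    (hb : 2 * t' + 3 ≤ b) (hc : 2 * t' + 3 ≤ c) (ht : t ≤ t') {P : Fin a × Fin b × Fin c}
    (h : P ∈ (shellBox a b c t e).dom a b c) (h' : P ∈ (shellBox a b c t' e').dom a b c) :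
    t = t' ∧ e = e' := by
  rw [Box.mem_dom] at h h'
  fin_cases e <;> simp only [shellBox] at h <;> fin_cases e' <;> simp only [shellBox] at h' <;>
    first
    | exact ⟨by omega, rfl⟩
    | exact absurd h' (by omega)

theorem notMem_shellBox_of_mem_coreBox {a b c n t : ℕ} {e : Fin 6} (ht : t ≤ n)
    {P : Fin a × Fin b × Fin c} (h : P ∈ (coreBox a b c n).dom a b c) :
    P ∉ (shellBox a b c t e).dom a b c := by
  intro h'
  rw [Box.mem_dom] at h h'
  simp only [coreBox] at h
  fin_cases e <;> simp only [shellBox] at h' <;> omega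

theorem box_eq_of_mem {a b c n : ℕ} (ha : 2 * n + 3 ≤ a) (hb : 2 * n + 3 ≤ b)
    (hc : 2 * n + 3 ≤ c) {k k' : Option (Fin (n + 1) × Fin 6)} {P : Fin a × Fin b × Fin c}
    (h : P ∈ (box a b c n k).dom a b c) (h' : P ∈ (box a b c n k').dom a b c) : k = k' := by
  rcases k with _ | ⟨t, e⟩ <;> rcases k' with _ | ⟨t', e'⟩
  · rfl
  · exact absurd h' (notMem_shellBox_of_mem_coreBox (by omega) h)
  · exact absurd h (notMem_shellBox_of_mem_coreBox (by omega) h')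
  · have h1 := t.2
    have h2 := t'.2
    rcases le_total (t : ℕ) t' with ht | ht
    · obtain ⟨h3, rfl⟩ := shellBox_eq_of_mem (by omega) (by omega) (by omega) ht h h'
      rw [Fin.ext h3]
    · obtain ⟨h3, rfl⟩ := shellBox_eq_of_mem (by omega) (by omega) (by omega) ht h' h
      rw [Fin.ext h3]

/-- The states of a box other than the constant one. -/
def Box.states (B : Box) (a b c : ℕ) : Set (Tri a b c) :=
  {ψ | ∃ s ∈ B.idx, s ≠ 0 ∧ B.vec a b c s = ψ}

theorem Box.mem_idx {B : Box} {s : ℕ × ℕ × ℕ} :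
    s ∈ B.idx ↔ s.1 < B.p ∧ s.2.1 < B.q ∧ s.2.2 < B.r := by
  simp [Box.idx]

/-! ### The given families as states of boxes -/

theorem xi_eq_four (d n s : ℕ) : xi d n s = four d (n + 1) (d - 2 * n - 1) s := by
  simp only [xi, four, add_right_comm]

theorem beta_eq_four (d n s : ℕ) : beta d n s = four d (n + 1) (d - 2 * n - 2) s := by
  simp only [beta, four, add_right_comm]

theorem setA1_eq (a b c t : ℕ) : setA1 a b c t = (shellBox a b c t 0).states a b c := by
  ext ψ
  constructor
  · rintro ⟨⟨i, k⟩, ⟨h1, h2, h3⟩, rfl⟩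
    refine ⟨(i, 0, k), Box.mem_idx.2 ⟨h1, one_pos, h2⟩, fun h => h3 ?_, ?_⟩
    · simp_all [Prod.ext_iff]
    · simp only [ket_eq_four, xi_eq_four]; rfl
  · rintro ⟨⟨i, j, k⟩, h1, h2, rfl⟩
    obtain ⟨h1, h3, h4⟩ := Box.mem_idx.1 h1
    obtain rfl : j = 0 := Nat.lt_one_iff.1 h3
    refine ⟨(i, k), ⟨h1, h4, fun h => h2 ?_⟩, ?_⟩
    · simp_all [Prod.ext_iff]
    · simp only [ket_eq_four, xi_eq_four]; rfl

theorem setA2_eq (a b c t : ℕ) : setA2 a b c t = (shellBox a b c t 1).states a b c := by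
  ext ψ
  constructor
  · rintro ⟨⟨i, j⟩, ⟨h1, h2, h3⟩, rfl⟩
    refine ⟨(i, j, 0), Box.mem_idx.2 ⟨h1, h2, one_pos⟩, fun h => h3 ?_, ?_⟩
    · simp_all [Prod.ext_iff]
    · simp only [ket_eq_four, xi_eq_four]; rfl
  · rintro ⟨⟨i, j, k⟩, h1, h2, rfl⟩
    obtain ⟨h1, h3, h4⟩ := Box.mem_idx.1 h1
    obtain rfl : k = 0 := Nat.lt_one_iff.1 h4
    refine ⟨(i, j), ⟨h1, h3, fun h => h2 ?_⟩, ?_⟩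
    · simp_all [Prod.ext_iff]
    · simp only [ket_eq_four, xi_eq_four]; rfl

theorem setA3_eq (a b c t : ℕ) : setA3 a b c t = (shellBox a b c t 2).states a b c := by
  ext ψ
  constructor
  · rintro ⟨⟨j, k⟩, ⟨h1, h2, h3⟩, rfl⟩
    refine ⟨(0, j, k), Box.mem_idx.2 ⟨one_pos, h1, h2⟩, fun h => h3 ?_, ?_⟩
    · simp_all [Prod.ext_iff]
    · simp only [ket_eq_four, xi_eq_four]; rfl
  · rintro ⟨⟨i, j, k⟩, h1, h2, rfl⟩
    obtain ⟨h1, h3, h4⟩ := Box.mem_idx.1 h1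
    obtain rfl : i = 0 := Nat.lt_one_iff.1 h1
    refine ⟨(j, k), ⟨h3, h4, fun h => h2 ?_⟩, ?_⟩
    · simp_all [Prod.ext_iff]
    · simp only [ket_eq_four, xi_eq_four]; rfl

theorem setB1_eq (a b c t : ℕ) : setB1 a b c t = (shellBox a b c t 3).states a b c := by
  ext ψ
  constructor
  · rintro ⟨⟨i, k⟩, ⟨h1, h2, h3⟩, rfl⟩
    refine ⟨(i, 0, k), Box.mem_idx.2 ⟨h1, one_pos, h2⟩, fun h => h3 ?_, ?_⟩
    · simp_all [Prod.ext_iff]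
    · simp only [ket_eq_four, xi_eq_four]; rfl
  · rintro ⟨⟨i, j, k⟩, h1, h2, rfl⟩
    obtain ⟨h1, h3, h4⟩ := Box.mem_idx.1 h1
    obtain rfl : j = 0 := Nat.lt_one_iff.1 h3
    refine ⟨(i, k), ⟨h1, h4, fun h => h2 ?_⟩, ?_⟩
    · simp_all [Prod.ext_iff]
    · simp only [ket_eq_four, xi_eq_four]; rfl

theorem setB2_eq (a b c t : ℕ) : setB2 a b c t = (shellBox a b c t 4).states a b c := by
  ext ψ
  constructor
  · rintro ⟨⟨i, j⟩, ⟨h1, h2, h3⟩, rfl⟩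
    refine ⟨(i, j, 0), Box.mem_idx.2 ⟨h1, h2, one_pos⟩, fun h => h3 ?_, ?_⟩
    · simp_all [Prod.ext_iff]
    · simp only [ket_eq_four, xi_eq_four]; rfl
  · rintro ⟨⟨i, j, k⟩, h1, h2, rfl⟩
    obtain ⟨h1, h3, h4⟩ := Box.mem_idx.1 h1
    obtain rfl : k = 0 := Nat.lt_one_iff.1 h4
    refine ⟨(i, j), ⟨h1, h3, fun h => h2 ?_⟩, ?_⟩
    · simp_all [Prod.ext_iff]
    · simp only [ket_eq_four, xi_eq_four]; rfl

theorem setB3_eq (a b c t : ℕ) : setB3 a b c t = (shellBox a b c t 5).states a b c := by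
  ext ψ
  constructor
  · rintro ⟨⟨j, k⟩, ⟨h1, h2, h3⟩, rfl⟩
    refine ⟨(0, j, k), Box.mem_idx.2 ⟨one_pos, h1, h2⟩, fun h => h3 ?_, ?_⟩
    · simp_all [Prod.ext_iff]
    · simp only [ket_eq_four, xi_eq_four]; rfl
  · rintro ⟨⟨i, j, k⟩, h1, h2, rfl⟩
    obtain ⟨h1, h3, h4⟩ := Box.mem_idx.1 h1
    obtain rfl : i = 0 := Nat.lt_one_iff.1 h1
    refine ⟨(j, k), ⟨h3, h4, fun h => h2 ?_⟩, ?_⟩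
    · simp_all [Prod.ext_iff]
    · simp only [ket_eq_four, xi_eq_four]; rfl

theorem setF_eq (a b c n : ℕ) : setF a b c n = (coreBox a b c n).states a b c := by
  ext ψ
  constructor
  · rintro ⟨s, ⟨h1, h2, h3, h4⟩, rfl⟩
    exact ⟨s, Box.mem_idx.2 ⟨h1, h2, h3⟩, h4, by simp only [beta_eq_four]; rfl⟩
  · rintro ⟨s, h1, h2, rfl⟩
    obtain ⟨h1, h3, h4⟩ := Box.mem_idx.1 h1
    exact ⟨s, ⟨h1, h3, h4, h2⟩, by simp only [beta_eq_four]; rfl⟩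

theorem mem_setU_iff {a b c n : ℕ} {ψ : Tri a b c} :
    ψ ∈ setU a b c n ↔ (∃ k, ψ ∈ (box a b c n k).states a b c) ∨ ψ = stopper a b c := by
  simp only [setU, setA1_eq, setA2_eq, setA3_eq, setB1_eq, setB2_eq, setB3_eq, setF_eq,
    Set.mem_union, Set.mem_iUnion, Set.mem_singleton_iff, Finset.mem_range, Option.exists,
    Prod.exists, box]
  constructor
  · rintro ((⟨t, ht, (((h | h) | h) | ((h | h) | h))⟩ | h) | h)
    · exact .inl (.inr ⟨⟨t, ht⟩, 0, h⟩)
    · exact .inl (.inr ⟨⟨t, ht⟩, 1, h⟩)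
    · exact .inl (.inr ⟨⟨t, ht⟩, 2, h⟩)
    · exact .inl (.inr ⟨⟨t, ht⟩, 3, h⟩)
    · exact .inl (.inr ⟨⟨t, ht⟩, 4, h⟩)
    · exact .inl (.inr ⟨⟨t, ht⟩, 5, h⟩)
    · exact .inl (.inl h)
    · exact .inr h
  · rintro ((h | ⟨t, e, h⟩) | h)
    · exact .inl (.inr h)
    · refine .inl (.inl ⟨t, t.2, ?_⟩)
      fin_cases e
      · exact .inl (.inl (.inl h))
      · exact .inl (.inl (.inr h))
      · exact .inl (.inr h)
      · exact .inr (.inl (.inl h))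
      · exact .inr (.inl (.inr h))
      · exact .inr (.inr h)
    · exact .inr h

/-! ### Orthogonality of the states -/

theorem sum_ket_apply (d : ℕ) (i : Fin d) : (∑ j ∈ Finset.range d, ket d j) i = 1 := by
  simp [WithLp.ofLp_sum, Finset.sum_apply, ket_apply]

theorem stopper_apply (a b c : ℕ) (P : Fin a × Fin b × Fin c) : stopper a b c P = 1 := by
  rw [stopper, triProd_apply, sum_ket_apply, sum_ket_apply, sum_ket_apply]; simp

theorem tri_inner {a b c : ℕ} (ψ φ : Tri a b c) : inner ℂ ψ φ = ∑ P, conj (ψ P) * φ P := by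
  simp [PiLp.inner_apply, mul_comm]

theorem inner_vec_vec {a b c n : ℕ} (ha : 2 * n + 3 ≤ a) (hb : 2 * n + 3 ≤ b)
    (hc : 2 * n + 3 ≤ c) {k k' : Option (Fin (n + 1) × Fin 6)} {s s' : ℕ × ℕ × ℕ}
    (hs : s ∈ (box a b c n k).idx) (hs' : s' ∈ (box a b c n k').idx) (h : k = k' → s ≠ s') :
    inner ℂ ((box a b c n k).vec a b c s) ((box a b c n k').vec a b c s') = 0 := by
  rw [tri_inner]
  by_cases hk : k = k'
  · subst hk
    rw [(box_valid ha hb hc k).fourierOn.orth s hs s' hs', if_neg (h rfl)]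
  · refine Finset.sum_eq_zero fun P _ => ?_
    by_cases hP : P ∈ (box a b c n k).dom a b c
    · have hP' : P ∉ (box a b c n k').dom a b c := fun h' => hk (box_eq_of_mem ha hb hc hP h')
      rw [(box_valid ha hb hc k').fourierOn.supp _ _ hP', mul_zero]
    · rw [(box_valid ha hb hc k).fourierOn.supp _ _ hP, map_zero, zero_mul]

theorem Box.Valid.inner_stopper_vec {B : Box} {a b c : ℕ} (h : B.Valid a b c) {s : ℕ × ℕ × ℕ}
    (hs : s ∈ B.idx) (h0 : s ≠ 0) : inner ℂ (stopper a b c) (B.vec a b c s) = 0 := by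
  rw [tri_inner]
  simp_rw [stopper_apply, map_one, one_mul]
  rw [h.fourierOn.sum_eq hs, if_neg h0]

theorem Box.Valid.vec_ne_zero {B : Box} {a b c : ℕ} (h : B.Valid a b c) {s : ℕ × ℕ × ℕ}
    (hs : s ∈ B.idx) : B.vec a b c s ≠ 0 := by
  intro h0
  have h1 := h.fourierOn.orth s hs s hs
  rw [h0] at h1
  simp [h.p_ne, h.q_ne, h.r_ne] at h1

theorem stopper_ne_zero {a b c : ℕ} (ha : 0 < a) (hb : 0 < b) (hc : 0 < c) :
    stopper a b c ≠ 0 := by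
  intro h
  have := stopper_apply a b c (⟨0, ha⟩, ⟨0, hb⟩, ⟨0, hc⟩)
  rw [h] at this
  simp at this

theorem isOPS_setU {a b c n : ℕ} (ha : 2 * n + 3 ≤ a) (hb : 2 * n + 3 ≤ b)
    (hc : 2 * n + 3 ≤ c) : IsOPS (setU a b c n) := by
  constructor
  · intro ψ hψ
    rcases mem_setU_iff.1 hψ with ⟨k, s, hs, -, rfl⟩ | rfl
    · exact ⟨(box_valid ha hb hc k).vec_ne_zero hs, _, _, _, rfl⟩
    · exact ⟨stopper_ne_zero (by omega) (by omega) (by omega), _, _, _, rfl⟩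
  · intro ψ hψ φ hφ hne
    rcases mem_setU_iff.1 hψ with ⟨k, s, hs, h0, rfl⟩ | rfl <;>
      rcases mem_setU_iff.1 hφ with ⟨k', s', hs', h0', rfl⟩ | rfl
    · refine inner_vec_vec ha hb hc hs hs' ?_
      rintro rfl rfl
      exact hne rfl
    · exact inner_eq_zero_symm.1 ((box_valid ha hb hc k).inner_stopper_vec hs h0)
    · exact (box_valid ha hb hc k').inner_stopper_vec hs' h0'
    · exact absurd rfl hne

/-! ### Cardinality and incompleteness -/

/-- The labels of the states of the boxes. -/
def labels (a b c n : ℕ) : Finset (Σ _ : Option (Fin (n + 1) × Fin 6), ℕ × ℕ × ℕ) :=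
  Finset.univ.sigma fun k => (box a b c n k).idx.erase 0

theorem setU_eq_insert_image (a b c n : ℕ) :
    setU a b c n = insert (stopper a b c)
      ((fun l : Σ _ : Option (Fin (n + 1) × Fin 6), ℕ × ℕ × ℕ =>
        (box a b c n l.1).vec a b c l.2) '' labels a b c n) := by
  ext ψ
  rw [mem_setU_iff, Set.mem_insert_iff, or_comm]
  refine or_congr Iff.rfl ?_
  constructor
  · rintro ⟨k, s, hs, h0, rfl⟩
    exact ⟨⟨k, s⟩, by simp [labels, hs, h0], rfl⟩
  · rintro ⟨⟨k, s⟩, h, rfl⟩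
    simp only [labels, Finset.coe_sigma, Set.mem_sigma_iff, Finset.mem_coe, Finset.mem_erase] at h
    exact ⟨k, s, h.2.2, h.2.1, rfl⟩

theorem vec_injective {a b c n : ℕ} (ha : 2 * n + 3 ≤ a) (hb : 2 * n + 3 ≤ b)
    (hc : 2 * n + 3 ≤ c) {k k' : Option (Fin (n + 1) × Fin 6)} {s s' : ℕ × ℕ × ℕ}
    (hs : s ∈ (box a b c n k).idx) (hs' : s' ∈ (box a b c n k').idx)
    (h : (box a b c n k).vec a b c s = (box a b c n k').vec a b c s') : k = k' ∧ s = s' := by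
  by_contra hne
  have := inner_vec_vec ha hb hc hs hs' fun h1 h2 => hne ⟨h1, h2⟩
  rw [← h, inner_self_eq_zero] at this
  exact (box_valid ha hb hc k).vec_ne_zero hs this

/-- The sum telescopes: each term is the difference of the volumes of two consecutive nested
cuboids, minus 2 for the uncovered corners and 6 for the omitted constants. -/
theorem sum_shell (a b c : ℤ) (n : ℕ) :
    ∑ t ∈ Finset.range (n + 1), (2 * ((a - 2 * t - 1) * (b - 2 * t - 1)
      + (b - 2 * t - 1) * (c - 2 * t - 1) + (a - 2 * t - 1) * (c - 2 * t - 1)) - 6)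
    = a * b * c - (a - 2 * n - 2) * (b - 2 * n - 2) * (c - 2 * n - 2) - 8 * (n + 1) := by
  induction n with
  | zero => simp; ring
  | succ n ih => rw [Finset.sum_range_succ, ih]; push_cast; ring

theorem card_labels {a b c n : ℕ} (ha : 2 * n + 3 ≤ a) (hb : 2 * n + 3 ≤ b)
    (hc : 2 * n + 3 ≤ c) :
    ((labels a b c n).card : ℤ) = (a : ℤ) * b * c - 8 * (n + 1) - 1 := by
  have hcard : ∀ k, (((box a b c n k).idx.erase 0).card : ℤ)
      = (box a b c n k).p * ((box a b c n k).q * (box a b c n k).r) - 1 := by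
    intro k
    rw [Finset.card_erase_of_mem (box_valid ha hb hc k).fourierOn.zero_mem, Nat.cast_sub
      (Finset.card_pos.2 ⟨0, (box_valid ha hb hc k).fourierOn.zero_mem⟩)]
    simp [Box.idx]
  rw [labels, Finset.card_sigma, Nat.cast_sum]
  simp_rw [hcard]
  rw [Fintype.sum_option, Fintype.sum_prod_type]
  simp only [Fin.sum_univ_six, box, shellBox, coreBox]
  have hsub : ∀ d t k : ℕ, 2 * t + k ≤ d → ((d - 2 * t - k : ℕ) : ℤ) = d - 2 * t - k := by
    intros; omega
  have hsum := sum_shell a b c n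
  rw [Finset.sum_range] at hsum
  rw [hsub a n 2 (by omega), hsub b n 2 (by omega), hsub c n 2 (by omega), ← eq_sub_iff_add_eq']
  refine Eq.trans (Finset.sum_congr rfl fun t _ => ?_) (hsum.trans (by push_cast; ring))
  have := t.2
  rw [hsub a t 1 (by omega), hsub b t 1 (by omega), hsub c t 1 (by omega)]
  push_cast
  ring

theorem ncard_setU {a b c n : ℕ} (ha : 2 * n + 3 ≤ a) (hb : 2 * n + 3 ≤ b)
    (hc : 2 * n + 3 ≤ c) :
    ((setU a b c n).ncard : ℤ) = (a : ℤ) * b * c - 8 * (n + 1) := by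
  rw [setU_eq_insert_image, Set.ncard_insert_of_notMem, Set.InjOn.ncard_image,
    Set.ncard_coe_finset]
  · have := card_labels ha hb hc
    push_cast
    rw [this]; ring
  · rintro ⟨k, s⟩ h ⟨k', s'⟩ h' he
    simp only [labels, Finset.coe_sigma, Set.mem_sigma_iff, Finset.mem_coe,
      Finset.mem_erase] at h h'
    obtain ⟨rfl, rfl⟩ := vec_injective ha hb hc h.2.2 h'.2.2 he
    rfl
  · rintro ⟨⟨k, s⟩, h, he⟩
    simp only [labels, Finset.coe_sigma, Set.mem_sigma_iff, Finset.mem_coe,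
      Finset.mem_erase] at h
    have := (box_valid ha hb hc k).inner_stopper_vec h.2.2 h.2.1
    simp only at he
    rw [he, inner_self_eq_zero] at this
    exact stopper_ne_zero (by omega) (by omega) (by omega) this

theorem span_setU_ne_top {a b c n : ℕ} (ha : 2 * n + 3 ≤ a) (hb : 2 * n + 3 ≤ b)
    (hc : 2 * n + 3 ≤ c) : Submodule.span ℂ (setU a b c n) ≠ ⊤ := by
  intro h
  have hfin : (setU a b c n).Finite := by
    rw [setU_eq_insert_image]
    exact ((Finset.finite_toSet _).image _).insert _
  let := hfin.fintype
  have h1 := finrank_span_le_card (R := ℂ) (setU a b c n)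
  rw [h, finrank_top, finrank_euclideanSpace] at h1
  have h2 := ncard_setU ha hb hc
  rw [← Set.ncard_eq_toFinset_card'] at h1
  simp only [Fintype.card_prod, Fintype.card_fin] at h1
  have h4 : ((a * (b * c) : ℕ) : ℤ) ≤ ((setU a b c n).ncard : ℤ) := by exact_mod_cast h1
  rw [h2] at h4
  push_cast at h4
  have : (a : ℤ) * (b * c) = a * b * c := by ring
  omega

/-! ### Unextendibility -/

/-- The product `κ * f * g` is constant on `(S ∖ {s}) × (T ∖ {t})`. -/
def FaceConst {α β : Type} (κ : ℂ) (f : α → ℂ) (S : Finset α) (s : α) (g : β → ℂ) (T : Finset β)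
    (t : β) : Prop :=
  ∀ i ∈ S, i ≠ s → ∀ i' ∈ S, i' ≠ s → ∀ j ∈ T, j ≠ t → ∀ j' ∈ T, j' ≠ t →
    κ * (f i * g j) = κ * (f i' * g j')

/-- If neither factor vanishes identically on its range, fixing one at a nonzero value and
cancelling shows that the other is constant. -/
theorem FaceConst.cases {α β : Type} {κ : ℂ} {f : α → ℂ} {S : Finset α} {s : α} {g : β → ℂ}
    {T : Finset β} {t : β} (h : FaceConst κ f S s g T t) (hκ : κ ≠ 0) :
    (∀ i ∈ S, i ≠ s → f i = 0) ∨ (∀ j ∈ T, j ≠ t → g j = 0) ∨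
      (∃ u ≠ 0, ∀ i ∈ S, i ≠ s → f i = u) ∧ ∃ v ≠ 0, ∀ j ∈ T, j ≠ t → g j = v := by
  by_cases h1 : ∀ i ∈ S, i ≠ s → f i = 0
  · exact .inl h1
  by_cases h2 : ∀ j ∈ T, j ≠ t → g j = 0
  · exact .inr (.inl h2)
  push Not at h1 h2
  obtain ⟨i, hi, his, hfi⟩ := h1
  obtain ⟨j, hj, hjt, hgj⟩ := h2
  refine .inr (.inr ⟨⟨f i, hfi, fun i' hi' hs' => ?_⟩, ⟨g j, hgj, fun j' hj' ht' => ?_⟩⟩)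
  · exact mul_right_cancel₀ hgj (mul_left_cancel₀ hκ (h i' hi' hs' i hi his j hj hjt j hj hjt))
  · exact mul_left_cancel₀ hfi (mul_left_cancel₀ hκ (h i hi his i hi his j' hj' ht' j hj hjt))

theorem sum_ne_zero_of_const {α : Type} {f : α → ℂ} {S : Finset α} {m : α} {u : ℂ} (hm : m ∈ S)
    (hu : u ≠ 0) (h : ∀ i ∈ S, f i = u) : ∑ i ∈ S, f i ≠ 0 := by
  rw [Finset.sum_congr rfl h, Finset.sum_const, nsmul_eq_mul]
  exact mul_ne_zero (by exact_mod_cast (Finset.card_pos.2 ⟨m, hm⟩).ne') hu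

theorem sum_ne_zero_of_const_of_zero {α : Type} {f : α → ℂ} {S : Finset α} {s m : α} {u : ℂ}
    (hm : m ∈ S) (hms : m ≠ s) (hu : u ≠ 0) (h : ∀ i ∈ S, i ≠ s → f i = u) (hs : f s = 0) :
    ∑ i ∈ S, f i ≠ 0 := by
  classical
  rw [← Finset.sum_erase S hs]
  exact sum_ne_zero_of_const (Finset.mem_erase.2 ⟨hms, hm⟩) hu fun i hi =>
    h i (Finset.mem_of_mem_erase hi) (Finset.ne_of_mem_erase hi)

theorem sum_ne_zero_of_single {α : Type} {f : α → ℂ} {S : Finset α} {s : α} (hs : s ∈ S)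
    (h : ∀ i ∈ S, i ≠ s → f i = 0) (hf : f s ≠ 0) : ∑ i ∈ S, f i ≠ 0 := by
  rwa [Finset.sum_eq_single s h fun hh => absurd hs hh]

theorem apply_ne_zero_of_forall {α : Type} {f : α → ℂ} {S : Finset α} {s : α}
    (h : ∀ i ∈ S, i ≠ s → f i = 0) (hf : ∃ i ∈ S, f i ≠ 0) : f s ≠ 0 := by
  obtain ⟨i, hi, hfi⟩ := hf
  by_cases his : i = s
  · exact his ▸ hfi
  · exact absurd (h i hi his) hfi

/-- An index set with a lowest, a highest and a middle element, and a function that does not vanish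
on it. -/
structure Side {α : Type} (f : α → ℂ) (S : Finset α) (l h m : α) : Prop where
  l_mem : l ∈ S
  h_mem : h ∈ S
  m_mem : m ∈ S
  l_ne_h : l ≠ h
  m_ne_l : m ≠ l
  m_ne_h : m ≠ h
  exists_ne : ∃ i ∈ S, f i ≠ 0

theorem Side.flip {α : Type} {f : α → ℂ} {S : Finset α} {l h m : α} (H : Side f S l h m) :
    Side f S h l m :=
  ⟨H.h_mem, H.l_mem, H.m_mem, H.l_ne_h.symm, H.m_ne_h, H.m_ne_l, H.exists_ne⟩

/-- The product `f ⊗ g ⊗ k` is constant on the six boxes of a shell and has zero sum. -/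
structure ShellConst {α β γ : Type} (f : α → ℂ) (R : Finset α) (lf hf : α)
    (g : β → ℂ) (S : Finset β) (lg hg : β) (k : γ → ℂ) (T : Finset γ) (lk hk : γ) : Prop where
  f_low : FaceConst (f lf) g S hg k T lk
  f_high : FaceConst (f hf) g S lg k T hk
  g_low : FaceConst (g lg) k T hk f R lf
  g_high : FaceConst (g hg) k T lk f R hf
  k_low : FaceConst (k lk) f R hf g S lg
  k_high : FaceConst (k hk) f R lf g S hg
  sum : ∑ i ∈ R, f i ≠ 0 → ∑ j ∈ S, g j ≠ 0 → ∑ l ∈ T, k l ≠ 0 → False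

section
variable {α β γ : Type} {f : α → ℂ} {R : Finset α} {lf hf mf : α}
  {g : β → ℂ} {S : Finset β} {lg hg mg : β} {k : γ → ℂ} {T : Finset γ} {lk hk mk : γ}

theorem ShellConst.rotate (H : ShellConst f R lf hf g S lg hg k T lk hk) :
    ShellConst g S lg hg k T lk hk f R lf hf :=
  ⟨H.g_low, H.g_high, H.k_low, H.k_high, H.f_low, H.f_high, fun h1 h2 h3 => H.sum h3 h1 h2⟩

theorem ShellConst.flip (H : ShellConst f R lf hf g S lg hg k T lk hk) :
    ShellConst f R hf lf g S hg lg k T hk lk :=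
  ⟨H.f_high, H.f_low, H.g_high, H.g_low, H.k_high, H.k_low, H.sum⟩

/-- If `f lf ≠ 0`, the box on this face leaves the three cases of `FaceConst.cases`. In each, the
neighbouring boxes determine the factors so far that each is either supported at one end, or a
nonzero constant off one end where it vanishes, or a nonzero constant throughout. All three sums are
then nonzero, or a factor vanishes where it must not. Rotation and flip carry the result to the
other five ends. -/
theorem ShellConst.low_eq_zero (H : ShellConst f R lf hf g S lg hg k T lk hk)
    (hF : Side f R lf hf mf) (hG : Side g S lg hg mg) (hK : Side k T lk hk mk) : f lf = 0 := by
  by_contra hx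
  rcases H.f_low.cases hx with hy | hz | ⟨⟨y, hy0, hy⟩, z, hz0, hz⟩
  · have hyh := apply_ne_zero_of_forall hy hG.exists_ne
    have hkl : k lk = 0 := by
      have := H.k_low lf hF.l_mem hF.l_ne_h lf hF.l_mem hF.l_ne_h hg hG.h_mem hG.l_ne_h.symm
        mg hG.m_mem hG.m_ne_l
      rw [hy mg hG.m_mem hG.m_ne_h] at this
      simpa [hx, hyh] using this
    rcases H.g_high.cases hyh with hz | hx' | ⟨⟨z, hz0, hz⟩, x, hx0, hx'⟩
    · exact apply_ne_zero_of_forall hz hK.exists_ne hkl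
    · exact hx (hx' lf hF.l_mem hF.l_ne_h)
    · have hfh : f hf = 0 := by
        have := H.f_high hg hG.h_mem hG.l_ne_h.symm mg hG.m_mem hG.m_ne_l mk hK.m_mem hK.m_ne_h
          mk hK.m_mem hK.m_ne_h
        rw [hy mg hG.m_mem hG.m_ne_h, hz mk hK.m_mem hK.m_ne_l] at this
        simpa [hyh, hz0] using this
      exact H.sum (sum_ne_zero_of_const_of_zero hF.m_mem hF.m_ne_h hx0 hx' hfh)
        (sum_ne_zero_of_single hG.h_mem hy hyh)
        (sum_ne_zero_of_const_of_zero hK.m_mem hK.m_ne_l hz0 hz hkl)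
  -- Case 2: `k` lives at its low end only.
  · have hzl := apply_ne_zero_of_forall hz hK.exists_ne
    rcases H.k_low.cases hzl with hx' | hy | ⟨⟨x, hx0, hx'⟩, y, hy0, hy⟩
    · exact hx (hx' lf hF.l_mem hF.l_ne_h)
    · have hyl := apply_ne_zero_of_forall hy hG.exists_ne
      have hx' : ∀ i ∈ R, i ≠ lf → f i = 0 := by
        intro i hi hil
        have := H.g_low lk hK.l_mem hK.l_ne_h mk hK.m_mem hK.m_ne_h i hi hil i hi hil
        rw [hz mk hK.m_mem hK.m_ne_l] at this
        simpa [hyl, hzl] using this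
      exact H.sum (sum_ne_zero_of_single hF.l_mem hx' hx) (sum_ne_zero_of_single hG.l_mem hy hyl)
        (sum_ne_zero_of_single hK.l_mem hz hzl)
    · have hgl : g lg = 0 := by
        have := H.g_low lk hK.l_mem hK.l_ne_h mk hK.m_mem hK.m_ne_h mf hF.m_mem hF.m_ne_l
          mf hF.m_mem hF.m_ne_l
        rw [hz mk hK.m_mem hK.m_ne_l, hx' mf hF.m_mem hF.m_ne_h] at this
        simpa [hx0, hzl] using this
      have hfh : f hf = 0 := by
        have := H.f_high mg hG.m_mem hG.m_ne_l mg hG.m_mem hG.m_ne_l lk hK.l_mem hK.l_ne_h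
          mk hK.m_mem hK.m_ne_h
        rw [hz mk hK.m_mem hK.m_ne_l, hy mg hG.m_mem hG.m_ne_l] at this
        simpa [hy0, hzl] using this
      exact H.sum (sum_ne_zero_of_const_of_zero hF.m_mem hF.m_ne_h hx0 hx' hfh)
        (sum_ne_zero_of_const_of_zero hG.m_mem hG.m_ne_l hy0 hy hgl)
        (sum_ne_zero_of_single hK.l_mem hz hzl)
  -- Case 3: `g` and `k` are nonzero constants off one end each. Either `f` lives at its low end
  -- only, or the constants from overlapping ranges agree at the middle indices and all three
  -- factors are constant throughout.
  · have hzh : k hk ≠ 0 := by rw [hz hk hK.h_mem hK.l_ne_h.symm]; exact hz0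
    have hzm := hz mk hK.m_mem hK.m_ne_l
    have hym := hy mg hG.m_mem hG.m_ne_h
    rcases H.k_high.cases hzh with hx' | hy' | ⟨⟨x, hx0, hx'⟩, -⟩
    · have hxm := hx' mf hF.m_mem hF.m_ne_l
      have hgh : g hg = 0 := by
        have := H.g_high mk hK.m_mem hK.m_ne_l mk hK.m_mem hK.m_ne_l lf hF.l_mem hF.l_ne_h
          mf hF.m_mem hF.m_ne_h
        rw [hxm, hzm] at this
        simpa [hx, hz0] using this
      have hkl : k lk = 0 := by
        have := H.k_low lf hF.l_mem hF.l_ne_h mf hF.m_mem hF.m_ne_h mg hG.m_mem hG.m_ne_l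
          mg hG.m_mem hG.m_ne_l
        rw [hxm, hym] at this
        simpa [hx, hy0] using this
      exact H.sum (sum_ne_zero_of_single hF.l_mem hx' hx)
        (sum_ne_zero_of_const_of_zero hG.m_mem hG.m_ne_h hy0 hy hgh)
        (sum_ne_zero_of_const_of_zero hK.m_mem hK.m_ne_l hz0 hz hkl)
    · exact hy0 (hym.symm.trans (hy' mg hG.m_mem hG.m_ne_h))
    · have hxm := hx' mf hF.m_mem hF.m_ne_l
      have hxh : f hf ≠ 0 := by rw [hx' hf hF.h_mem hF.l_ne_h.symm]; exact hx0
      rcases H.f_high.cases hxh with hy' | hz' | ⟨⟨y', -, hy'⟩, z', -, hz'⟩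
      · exact hy0 (hym.symm.trans (hy' mg hG.m_mem hG.m_ne_l))
      · exact hz0 (hzm.symm.trans (hz' mk hK.m_mem hK.m_ne_h))
      · obtain rfl : y' = y := (hy' mg hG.m_mem hG.m_ne_l).symm.trans hym
        obtain rfl : z' = z := (hz' mk hK.m_mem hK.m_ne_h).symm.trans hzm
        have hyh : g hg ≠ 0 := by rw [hy' hg hG.h_mem hG.l_ne_h.symm]; exact hy0
        rcases H.g_high.cases hyh with hz'' | hx'' | ⟨-, x', -, hx''⟩
        · exact hz0 (hzm.symm.trans (hz'' mk hK.m_mem hK.m_ne_l))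
        · exact hx0 (hxm.symm.trans (hx'' mf hF.m_mem hF.m_ne_h))
        · obtain rfl : x' = x := (hx'' mf hF.m_mem hF.m_ne_h).symm.trans hxm
          refine H.sum (sum_ne_zero_of_const hF.m_mem hx0 fun i hi => ?_)
            (sum_ne_zero_of_const hG.m_mem hy0 fun i hi => ?_)
            (sum_ne_zero_of_const hK.m_mem hz0 fun i hi => ?_)
          · by_cases h : i = hf
            · exact hx' i hi (h ▸ hF.l_ne_h.symm)
            · exact hx'' i hi h
          · by_cases h : i = hg
            · exact hy' i hi (h ▸ hG.l_ne_h.symm)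
            · exact hy i hi h
          · by_cases h : i = hk
            · exact hz i hi (h ▸ hK.l_ne_h.symm)
            · exact hz' i hi h

theorem ShellConst.high_eq_zero (H : ShellConst f R lf hf g S lg hg k T lk hk)
    (hF : Side f R lf hf mf) (hG : Side g S lg hg mg) (hK : Side k T lk hk mk) : f hf = 0 :=
  H.flip.low_eq_zero hF.flip hG.flip hK.flip

end

/-- The indices `t, …, d - 1 - t`. -/
def layer (d t : ℕ) : Finset (Fin d) := Finset.univ.filter fun i => t ≤ i ∧ (i : ℕ) + t < d

theorem mem_layer {d t : ℕ} {i : Fin d} : i ∈ layer d t ↔ t ≤ i ∧ (i : ℕ) + t < d := by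
  simp [layer]

theorem sum_layer {d t : ℕ} {f : Fin d → ℂ} (h : ∀ i, f i ≠ 0 → i ∈ layer d t) :
    ∑ i ∈ layer d t, f i = ∑ i, f i :=
  Finset.sum_subset (Finset.subset_univ _) fun i _ hi => by
    by_contra h0; exact hi (h i h0)

theorem side_layer {d t : ℕ} (hd : 2 * t + 3 ≤ d) {f : Fin d → ℂ}
    (h : ∀ i, f i ≠ 0 → i ∈ layer d t) (hf : ∃ i, f i ≠ 0) :
    Side f (layer d t) ⟨t, by omega⟩ ⟨d - 1 - t, by omega⟩ ⟨t + 1, by omega⟩ where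
  l_mem := mem_layer.2 (by simp only; omega)
  h_mem := mem_layer.2 (by simp only; omega)
  m_mem := mem_layer.2 (by simp only; omega)
  l_ne_h := by rw [Ne, Fin.ext_iff]; simp only; omega
  m_ne_l := by rw [Ne, Fin.ext_iff]; simp only; omega
  m_ne_h := by rw [Ne, Fin.ext_iff]; simp only; omega
  exists_ne := hf.imp fun i hi => ⟨h i hi, hi⟩

theorem mem_layer_succ {d t : ℕ} (hd : 2 * t + 3 ≤ d) {f : Fin d → ℂ}
    (h : ∀ i, f i ≠ 0 → i ∈ layer d t) (hl : f ⟨t, by omega⟩ = 0)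
    (hh : f ⟨d - 1 - t, by omega⟩ = 0) : ∀ i, f i ≠ 0 → i ∈ layer d (t + 1) := by
  intro i hi
  have h1 := mem_layer.1 (h i hi)
  have h2 : (i : ℕ) ≠ t := by rintro h2; exact hi ((congrArg f (Fin.ext h2)).trans hl)
  have h3 : (i : ℕ) ≠ d - 1 - t := by rintro h2; exact hi ((congrArg f (Fin.ext h2)).trans hh)
  rw [mem_layer]; omega

theorem shellConst_of_box {a b c t : ℕ} (ha : 2 * t + 3 ≤ a) (hb : 2 * t + 3 ≤ b)
    (hc : 2 * t + 3 ≤ c) {x : Fin a → ℂ} {y : Fin b → ℂ} {z : Fin c → ℂ}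
    (hconst : ∀ e, ∀ P ∈ (shellBox a b c t e).dom a b c, ∀ Q ∈ (shellBox a b c t e).dom a b c,
      x P.1 * y P.2.1 * z P.2.2 = x Q.1 * y Q.2.1 * z Q.2.2)
    (hsum : (∑ i ∈ layer a t, x i) * (∑ i ∈ layer b t, y i) * (∑ i ∈ layer c t, z i) = 0) :
    ShellConst x (layer a t) ⟨t, by omega⟩ ⟨a - 1 - t, by omega⟩
      y (layer b t) ⟨t, by omega⟩ ⟨b - 1 - t, by omega⟩
      z (layer c t) ⟨t, by omega⟩ ⟨c - 1 - t, by omega⟩ where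
  f_low j hj hj0 j' hj' hj0' k hk hk0 k' hk' hk0' := by
    simp only [mem_layer, Ne, Fin.ext_iff] at *
    have := hconst 5 (⟨t, by omega⟩, j, k) (by rw [Box.mem_dom]; simp only [shellBox]; omega)
      (⟨t, by omega⟩, j', k') (by rw [Box.mem_dom]; simp only [shellBox]; omega)
    linear_combination this
  f_high j hj hj0 j' hj' hj0' k hk hk0 k' hk' hk0' := by
    simp only [mem_layer, Ne, Fin.ext_iff] at *
    have := hconst 2 (⟨a - 1 - t, by omega⟩, j, k)
      (by rw [Box.mem_dom]; simp only [shellBox]; omega)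
      (⟨a - 1 - t, by omega⟩, j', k') (by rw [Box.mem_dom]; simp only [shellBox]; omega)
    linear_combination this
  g_low k hk hk0 k' hk' hk0' i hi hi0 i' hi' hi0' := by
    simp only [mem_layer, Ne, Fin.ext_iff] at *
    have := hconst 0 (i, ⟨t, by omega⟩, k) (by rw [Box.mem_dom]; simp only [shellBox]; omega)
      (i', ⟨t, by omega⟩, k') (by rw [Box.mem_dom]; simp only [shellBox]; omega)
    linear_combination this
  g_high k hk hk0 k' hk' hk0' i hi hi0 i' hi' hi0' := by
    simp only [mem_layer, Ne, Fin.ext_iff] at *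
    have := hconst 3 (i, ⟨b - 1 - t, by omega⟩, k)
      (by rw [Box.mem_dom]; simp only [shellBox]; omega)
      (i', ⟨b - 1 - t, by omega⟩, k') (by rw [Box.mem_dom]; simp only [shellBox]; omega)
    linear_combination this
  k_low i hi hi0 i' hi' hi0' j hj hj0 j' hj' hj0' := by
    simp only [mem_layer, Ne, Fin.ext_iff] at *
    have := hconst 4 (i, j, ⟨t, by omega⟩) (by rw [Box.mem_dom]; simp only [shellBox]; omega)
      (i', j', ⟨t, by omega⟩) (by rw [Box.mem_dom]; simp only [shellBox]; omega)
    linear_combination this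
  k_high i hi hi0 i' hi' hi0' j hj hj0 j' hj' hj0' := by
    simp only [mem_layer, Ne, Fin.ext_iff] at *
    have := hconst 1 (i, j, ⟨c - 1 - t, by omega⟩)
      (by rw [Box.mem_dom]; simp only [shellBox]; omega)
      (i', j', ⟨c - 1 - t, by omega⟩) (by rw [Box.mem_dom]; simp only [shellBox]; omega)
    linear_combination this
  sum h1 h2 h3 := mul_ne_zero (mul_ne_zero h1 h2) h3 hsum

theorem not_isProductState_of_mem_orthogonal {a b c n : ℕ} (ha : 2 * n + 3 ≤ a)
    (hb : 2 * n + 3 ≤ b) (hc : 2 * n + 3 ≤ c) {ψ : Tri a b c}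
    (hψ : ψ ∈ (Submodule.span ℂ (setU a b c n))ᗮ) : ¬ IsProductState ψ := by
  rintro ⟨hne, x, y, z, rfl⟩
  have horth : ∀ φ ∈ setU a b c n, ∑ P, conj (φ P) * triProd x y z P = 0 := by
    intro φ hφ
    rw [← tri_inner]
    exact Submodule.inner_right_of_mem_orthogonal (Submodule.subset_span hφ) hψ
  have hconst : ∀ k, ∀ P ∈ (box a b c n k).dom a b c, ∀ Q ∈ (box a b c n k).dom a b c,
      x P.1 * y P.2.1 * z P.2.2 = x Q.1 * y Q.2.1 * z Q.2.2 := by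
    intro k P hP Q hQ
    exact (box_valid ha hb hc k).fourierOn.star_eq_of_mem (fun P => triProd x y z P)
      (fun s hs h0 => horth _ (mem_setU_iff.2 (.inl ⟨k, s, hs, h0, rfl⟩))) hP hQ
  have hsum : (∑ i, x i) * (∑ j, y j) * (∑ k, z k) = 0 := by
    have := horth _ (mem_setU_iff.2 (.inr rfl))
    simp_rw [stopper_apply, map_one, one_mul, triProd_apply] at this
    rw [← this, Fintype.sum_prod_type]
    simp_rw [Fintype.sum_prod_type]
    rw [Finset.sum_mul_sum, Finset.sum_mul]
    simp_rw [Finset.sum_mul_sum]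
  have hx : ∃ i, x i ≠ 0 := by
    by_contra! h; exact hne (by ext P; simp [triProd_apply, h])
  have hy : ∃ i, y i ≠ 0 := by
    by_contra! h; exact hne (by ext P; simp [triProd_apply, h])
  have hz : ∃ i, z i ≠ 0 := by
    by_contra! h; exact hne (by ext P; simp [triProd_apply, h])
  -- Peeling: once the supports lie in layer `t`, the total sum is the sum over that layer, so the
  -- shell argument applies again.
  have hsupp : ∀ t ≤ n + 1, (∀ i, x i ≠ 0 → i ∈ layer a t) ∧ (∀ i, y i ≠ 0 → i ∈ layer b t) ∧
      ∀ i, z i ≠ 0 → i ∈ layer c t := by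
    intro t
    induction t with
    | zero => simp [mem_layer]
    | succ t ih =>
      intro ht
      obtain ⟨h1, h2, h3⟩ := ih (by omega)
      have hA := side_layer (t := t) (by omega) h1 hx
      have hB := side_layer (t := t) (by omega) h2 hy
      have hC := side_layer (t := t) (by omega) h3 hz
      have H : ShellConst x _ _ _ y _ _ _ z _ _ _ :=
        shellConst_of_box (t := t) (by omega) (by omega) (by omega)
          (fun e => hconst (some (⟨t, by omega⟩, e)))
          (by rw [sum_layer h1, sum_layer h2, sum_layer h3, hsum])
      exact ⟨mem_layer_succ (by omega) h1 (H.low_eq_zero hA hB hC) (H.high_eq_zero hA hB hC),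
        mem_layer_succ (by omega) h2 (H.rotate.low_eq_zero hB hC hA)
          (H.rotate.high_eq_zero hB hC hA),
        mem_layer_succ (by omega) h3 (H.rotate.rotate.low_eq_zero hC hA hB)
          (H.rotate.rotate.high_eq_zero hC hA hB)⟩
  obtain ⟨h1, h2, h3⟩ := hsupp (n + 1) le_rfl
  obtain ⟨i, hi⟩ := hx
  obtain ⟨j, hj⟩ := hy
  obtain ⟨k, hk⟩ := hz
  have hcore : ∀ i' ∈ layer a (n + 1), ∀ j' ∈ layer b (n + 1), ∀ k' ∈ layer c (n + 1),
      x i' * y j' * z k' = x i * y j * z k := by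
    intro i' hi' j' hj' k' hk'
    have e1 := mem_layer.1 (h1 i hi)
    have e2 := mem_layer.1 (h2 j hj)
    have e3 := mem_layer.1 (h3 k hk)
    rw [mem_layer] at hi' hj' hk'
    exact hconst none (i', j', k') (by rw [Box.mem_dom]; simp only [box, coreBox]; omega)
      (i, j, k) (by rw [Box.mem_dom]; simp only [box, coreBox]; omega)
  rw [← sum_layer h1, ← sum_layer h2, ← sum_layer h3] at hsum
  refine mul_ne_zero (mul_ne_zero (sum_ne_zero_of_const (h1 i hi) hi fun i' hi' => ?_)
    (sum_ne_zero_of_const (h2 j hj) hj fun j' hj' => ?_))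
    (sum_ne_zero_of_const (h3 k hk) hk fun k' hk' => ?_) hsum
  · exact mul_right_cancel₀ hj (mul_right_cancel₀ hk (hcore i' hi' j (h2 j hj) k (h3 k hk)))
  · exact mul_left_cancel₀ hi (mul_right_cancel₀ hk (hcore i (h1 i hi) j' hj' k (h3 k hk)))
  · exact mul_left_cancel₀ (mul_ne_zero hi hj) (hcore i (h1 i hi) j (h2 j hj) k' hk')

theorem isUPB_setU {a b c n : ℕ} (ha : 2 * n + 3 ≤ a) (hb : 2 * n + 3 ≤ b)
    (hc : 2 * n + 3 ≤ c) : IsUPB (setU a b c n) :=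
  ⟨isOPS_setU ha hb hc, span_setU_ne_top ha hb hc,
    fun _ => not_isProductState_of_mem_orthogonal ha hb hc⟩

/-! ### Orthogonality-preserving operators on two of the three parties are trivial -/

/-- Let `E` be a Hermitian form that is diagonal on the nonconstant functions of a Fourier family on
`D`, has constant column sums on `D`, and vanishes between `D` and everything else but one point `o`.
Suppose that `E` also vanishes between the parts `Col`, `Row ∖ Col` (together with `o`) and the rest
of `D ∪ {o}`, and that every pair of distinct points of `D` can be shifted into different parts.
Then all off-diagonal entries of `E` on `D ∪ {o}` vanish. -/
theorem FourierOn.offDiag_eq_zero {T S : Type} [Fintype T] [DecidableEq T] [Zero S]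
    [DecidableEq S] {D : Set T} {I : Finset S} {φ : S → T → ℂ} {N : ℕ} (hF : FourierOn D I φ N)
    {E : T → T → ℂ} (hE : ∀ p q, conj (E p q) = E q p) {o : T} (ho : o ∉ D) {Col Row : T → Prop}
    {κ : ℂ}
    (hdiag : ∀ s ∈ I, ∀ s' ∈ I, s ≠ 0 → s' ≠ 0 → s ≠ s' →
      ∑ p, ∑ q, conj (φ s p) * E p q * φ s' q = 0)
    (hsum : ∀ q ∈ D, ∑ p, E p q = κ)
    (hout : ∀ p ∉ D, p ≠ o → ∀ q ∈ D, E p q = 0)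
    (ho_zero : ∀ q ∈ D, Col q ∨ ¬ Row q → E o q = 0)
    (hcol : ∀ p ∈ D, ∀ q ∈ D, Col p → ¬ Col q → E p q = 0)
    (hrow : ∀ p ∈ D, ∀ q ∈ D, ¬ Col p → ¬ Col q → Row p → ¬ Row q → E p q = 0)
    (hne : ∃ p ∈ D, Col p)
    (hshift : ∀ p ∈ D, ∀ q ∈ D, p ≠ q → ∃ p' ∈ D, ∃ q' ∈ D,
      (∀ s, φ s p * conj (φ s q) = φ s p' * conj (φ s q')) ∧ ¬ Col q' ∧ ¬ Row q' ∧
      (Col p' ∨ (¬ (Col p ∧ ¬ Col q) ∧ ¬ Col p' ∧ Row p'))) :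
    (∀ p ∈ D, ∀ q ∈ D, p ≠ q → E p q = 0) ∧ ∀ q ∈ D, E o q = 0 := by
  classical
  have hN : (N : ℂ) ≠ 0 := by exact_mod_cast hF.pos
  have hφ0 : ∀ p, φ 0 p = if p ∈ D then 1 else 0 := by
    intro p
    split_ifs with hp
    · exact hF.zero_apply p hp
    · exact hF.supp 0 p hp
  -- The column sums over `D` alone are `κ - E o q`. Spreading the row of `o` evenly over `D` makes
  -- them constant up to a term independent of `q`, so `G` is also diagonal against the constant
  -- function. Pairings of nonconstant functions are unchanged, because these have zero sum.
  let G : T → T → ℂ := fun p q => E p q + (N : ℂ)⁻¹ * (E o q + conj (E o p))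
  have hGherm : ∀ p q, conj (G p q) = G q p := by
    intro p q
    simp only [G, map_add, map_mul, map_inv₀, hE, Complex.conj_natCast]
    ring
  have hexp : ∀ s s', ∑ p, ∑ q, conj (φ s p) * G p q * φ s' q
      = ∑ p, ∑ q, conj (φ s p) * E p q * φ s' q
        + (N : ℂ)⁻¹ * ((∑ p, conj (φ s p)) * ∑ q, E o q * φ s' q)
        + (N : ℂ)⁻¹ * ((∑ p, conj (φ s p) * conj (E o p)) * ∑ q, φ s' q) := by
    intro s s'
    rw [Finset.sum_mul_sum, Finset.sum_mul_sum]
    simp_rw [Finset.mul_sum, ← Finset.sum_add_distrib]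
    refine Finset.sum_congr rfl fun p _ => Finset.sum_congr rfl fun q _ => ?_
    simp only [G]; ring
  have hconj : ∀ s ∈ I, s ≠ 0 → ∑ p, conj (φ s p) = 0 := by
    intro s hs h0
    rw [← map_sum, hF.sum_eq hs, if_neg h0, map_zero]
  have hzero : ∀ s ∈ I, s ≠ 0 → ∑ p, ∑ q, conj (φ 0 p) * G p q * φ s q = 0 := by
    intro s hs h0
    have e0 : ∑ p, conj (φ 0 p) = N := by rw [← map_sum, hF.sum_eq hF.zero_mem]; simp
    have e1 : ∑ q, φ s q = 0 := by rw [hF.sum_eq hs, if_neg h0]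
    have e2 : ∀ q ∈ D, ∑ p, conj (φ 0 p) * E p q = κ - E o q := by
      intro q hq
      rw [← hsum q hq, eq_sub_iff_add_eq, ← Finset.sum_erase_add _ _ (Finset.mem_univ o),
        ← Finset.sum_erase_add (Finset.univ : Finset T) (fun p => E p q) (Finset.mem_univ o)]
      congr 1
      rw [hφ0 o, if_neg ho, map_zero, zero_mul, add_zero]
      refine Finset.sum_congr rfl fun p hp => ?_
      rw [hφ0]
      split_ifs with hpD
      · simp
      · rw [hout p hpD (Finset.ne_of_mem_erase hp) q hq]; simp
    have e3 : ∑ p, ∑ q, conj (φ 0 p) * E p q * φ s q = ∑ q, (κ - E o q) * φ s q := by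
      rw [Finset.sum_comm]
      refine Finset.sum_congr rfl fun q _ => ?_
      rw [← Finset.sum_mul]
      by_cases hq : q ∈ D
      · rw [e2 q hq]
      · rw [hF.supp s q hq]; simp
    rw [hexp, e0, e1, e3]
    simp_rw [sub_mul]
    rw [Finset.sum_sub_distrib, ← Finset.mul_sum, e1, ← mul_assoc, inv_mul_cancel₀ hN]
    ring
  have hGdiag : ∀ s ∈ I, ∀ s' ∈ I, s ≠ s' → ∑ p, ∑ q, conj (φ s p) * G p q * φ s' q = 0 := by
    intro s hs s' hs' hss
    by_cases h0 : s = 0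
    · subst h0
      exact hzero s' hs' (Ne.symm hss)
    by_cases h0' : s' = 0
    · subst h0'
      have := congrArg conj (hzero s hs h0)
      rw [map_zero] at this
      rw [← this, Finset.sum_comm, map_sum]
      refine Finset.sum_congr rfl fun p _ => ?_
      rw [map_sum]
      refine Finset.sum_congr rfl fun q _ => ?_
      rw [map_mul, map_mul, Complex.conj_conj, hGherm]; ring
    · rw [hexp, hdiag s hs s' hs' h0 h0' hss, hconj s hs h0, hF.sum_eq hs', if_neg h0']
      ring
  -- `G` is shift invariant, and the shifted pair is chosen so that all three terms of `G` are known
  -- zeros.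
  have hGcol : ∀ p ∈ D, ∀ q ∈ D, Col p → ¬ Col q → G p q = 0 := by
    intro p hp q hq hcp hcq
    obtain ⟨p', hp', q', hq', hcorr, h1, h2, h3⟩ := hshift p hp q hq (by rintro rfl; exact hcq hcp)
    have h3 : Col p' := h3.resolve_right fun h => h.1 ⟨hcp, hcq⟩
    rw [hF.eq_of_diagonal G hGdiag hp hq hp' hq' fun s _ => hcorr s]
    simp only [G]
    rw [hcol p' hp' q' hq' h3 h1, ho_zero q' hq' (.inr h2), ho_zero p' hp' (.inl h3)]
    simp
  -- For `p` in `Col` and `q` outside it, the only surviving term of `G p q = 0` is `E o q / N`.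
  have hozero : ∀ q ∈ D, E o q = 0 := by
    intro q hq
    by_cases hcq : Col q
    · exact ho_zero q hq (.inl hcq)
    · obtain ⟨p, hp, hcp⟩ := hne
      have := hGcol p hp q hq hcp hcq
      simp only [G] at this
      rw [hcol p hp q hq hcp hcq, ho_zero p hp (.inl hcp)] at this
      simpa [hF.pos] using this
  have hGE : ∀ p ∈ D, ∀ q ∈ D, G p q = E p q := by
    intro p hp q hq
    simp only [G]
    rw [hozero p hp, hozero q hq]
    simp
  refine ⟨fun p hp q hq hpq => ?_, hozero⟩
  obtain ⟨p', hp', q', hq', hcorr, h1, h2, h3⟩ := hshift p hp q hq hpq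
  rw [← hGE p hp q hq, hF.eq_of_diagonal G hGdiag hp hq hp' hq' fun s _ => hcorr s,
    hGE p' hp' q' hq']
  rcases h3 with h3 | ⟨-, h3, h4⟩
  · exact hcol p' hp' q' hq' h3 h1
  · exact hrow p' hp' q' hq' h3 h1 h4 h2

/-- With the line `v` as `Col` and the line `u` as `Row`, this supplies `hshift`. Points that differ
in the second coordinate are moved so that only the first lies on `v`. The others are moved off `v`
with only the first on `u`. -/
theorem exists_shift_rect {b c y q z r : ℕ} (hb : y + q ≤ b) (hc : z + r ≤ c) {u u' : Fin b}
    {v v' : Fin c} (hu : u ∈ ival b y q) (hu' : u' ∈ ival b y q) (huu : u' ≠ u)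
    (hv : v ∈ ival c z r) (hv' : v' ∈ ival c z r) (hvv : v' ≠ v) :
    ∀ P ∈ ival b y q ×ˢ ival c z r, ∀ Q ∈ ival b y q ×ˢ ival c z r, P ≠ Q →
      ∃ P' ∈ ival b y q ×ˢ ival c z r, ∃ Q' ∈ ival b y q ×ˢ ival c z r,
      (∀ s : ℕ × ℕ, four b y q s.1 P.1 * four c z r s.2 P.2 *
          conj (four b y q s.1 Q.1 * four c z r s.2 Q.2)
        = four b y q s.1 P'.1 * four c z r s.2 P'.2 *
          conj (four b y q s.1 Q'.1 * four c z r s.2 Q'.2)) ∧ ¬ Q'.2 = v ∧ ¬ Q'.1 = u ∧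
      (P'.2 = v ∨ (¬ (P.2 = v ∧ ¬ Q.2 = v) ∧ ¬ P'.2 = v ∧ P'.1 = u)) := by
  intro P hP Q hQ hPQ
  by_cases h : P.2 = Q.2
  · have h1 : P.1 ≠ Q.1 := fun h1 => hPQ (Prod.ext h1 h)
    obtain ⟨j, hj, hij, hcj⟩ := exists_shift hb hP.1 hQ.1 hu
    obtain ⟨k, hk, hik, hck⟩ := exists_shift hc hP.2 hQ.2 hv'
    refine ⟨(u, v'), ⟨hu, hv'⟩, (j, k), ⟨hj, hk⟩, fun s => ?_, ?_, ?_, .inr ⟨?_, hvv, rfl⟩⟩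
    · simp only [map_mul]
      linear_combination (four c z r s.2 P.2 * conj (four c z r s.2 Q.2)) * hcj s.1
        + (four b y q s.1 u * conj (four b y q s.1 j)) * hck s.2
    · rw [← hik.1 h]; exact hvv
    · exact fun h2 => h1 (hij.2 h2.symm)
    · rw [h]; tauto
  · obtain ⟨j, hj, -, hcj⟩ := exists_shift hb hQ.1 hP.1 hu'
    obtain ⟨k, hk, hik, hck⟩ := exists_shift hc hP.2 hQ.2 hv
    refine ⟨(j, v), ⟨hj, hv⟩, (u', k), ⟨hu', hk⟩, fun s => ?_, ?_, huu, .inl rfl⟩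
    · have := congrArg conj (hcj s.1)
      simp only [map_mul, Complex.conj_conj] at this ⊢
      linear_combination (four c z r s.2 P.2 * conj (four c z r s.2 Q.2)) * this
        + (four b y q s.1 j * conj (four b y q s.1 u')) * hck s.2
    · exact fun h2 => h (hik.2 h2.symm)

/-- The form `E` on the second and third party, extended by the identity on the first, vanishes on
pairs of distinct vectors of `U`. -/
def VanishesOffDiag {a b c : ℕ} (U : Set (Tri a b c)) (E : Fin b × Fin c → Fin b × Fin c → ℂ) :
    Prop :=
  ∀ ψ ∈ U, ∀ φ ∈ U, ψ ≠ φ → ∑ x, ∑ p, ∑ q, conj (ψ (x, p)) * E p q * φ (x, q) = 0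

def Box.face (B : Box) (b c : ℕ) (s : ℕ × ℕ) (p : Fin b × Fin c) : ℂ :=
  four b B.y B.q s.1 p.1 * four c B.z B.r s.2 p.2

def Box.faceDom (B : Box) (b c : ℕ) : Set (Fin b × Fin c) := ival b B.y B.q ×ˢ ival c B.z B.r

def Box.faceIdx (B : Box) : Finset (ℕ × ℕ) := Finset.range B.q ×ˢ Finset.range B.r

theorem Box.mem_faceDom {B : Box} {b c : ℕ} {P : Fin b × Fin c} :
    P ∈ B.faceDom b c ↔ (B.y ≤ P.1 ∧ (P.1 : ℕ) < B.y + B.q) ∧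
      (B.z ≤ P.2 ∧ (P.2 : ℕ) < B.z + B.r) :=
  Iff.rfl

theorem Box.Valid.fourierOn_face {B : Box} {a b c : ℕ} (h : B.Valid a b c) :
    FourierOn (B.faceDom b c) B.faceIdx (B.face b c) (B.q * B.r) :=
  (fourierOn_four h.q_ne h.y_le).prod (fourierOn_four h.r_ne h.z_le)

theorem sum_prod_form {X Y : Type} [Fintype X] [Fintype Y] (f f' : X → ℂ) (g g' : Y → ℂ)
    (E : Y → Y → ℂ) :
    ∑ x, ∑ p, ∑ q, conj (f x * g p) * E p q * (f' x * g' q)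
      = (∑ x, conj (f x) * f' x) * ∑ p, ∑ q, conj (g p) * E p q * g' q := by
  rw [Finset.sum_mul]
  refine Finset.sum_congr rfl fun x _ => ?_
  simp_rw [Finset.mul_sum]
  refine Finset.sum_congr rfl fun p _ => Finset.sum_congr rfl fun q _ => ?_
  rw [map_mul]; ring

/-- The form factors into the overlap of the first-party vectors and a form on the faces. A nonzero
overlap can be cancelled. -/
theorem VanishesOffDiag.face {a b c n : ℕ} (ha : 2 * n + 3 ≤ a) (hb : 2 * n + 3 ≤ b)
    (hc : 2 * n + 3 ≤ c) {E : Fin b × Fin c → Fin b × Fin c → ℂ}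
    (hE : VanishesOffDiag (setU a b c n) E)
    {k k' : Option (Fin (n + 1) × Fin 6)} {i i' : ℕ} {s s' : ℕ × ℕ}
    (hi : i < (box a b c n k).p) (hs : s ∈ (box a b c n k).faceIdx)
    (hi' : i' < (box a b c n k').p) (hs' : s' ∈ (box a b c n k').faceIdx)
    (h0 : (i, s) ≠ 0) (h0' : (i', s') ≠ 0) (hne : k = k' → (i, s) ≠ (i', s'))
    (hov : ∑ x, conj (four a (box a b c n k).x (box a b c n k).p i x) *
      four a (box a b c n k').x (box a b c n k').p i' x ≠ 0) :
    ∑ p, ∑ q, conj ((box a b c n k).face b c s p) * E p q * (box a b c n k').face b c s' q = 0 := by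
  have hm : (i, s) ∈ (box a b c n k).idx :=
    Finset.mem_product.2 ⟨Finset.mem_range.2 hi, hs⟩
  have hm' : (i', s') ∈ (box a b c n k').idx :=
    Finset.mem_product.2 ⟨Finset.mem_range.2 hi', hs'⟩
  have := hE _ (mem_setU_iff.2 (.inl ⟨k, _, hm, h0, rfl⟩))
    _ (mem_setU_iff.2 (.inl ⟨k', _, hm', h0', rfl⟩)) fun h => by
      obtain ⟨h1, h2⟩ := vec_injective ha hb hc hm hm' h
      exact hne h1 h2
  simp_rw [Box.vec_apply] at this
  exact (mul_eq_zero.1 ((sum_prod_form _ _ ((box a b c n k).face b c s)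
    ((box a b c n k').face b c s') E).symm.trans this)).resolve_left hov

/-- With first-party index 1 on both sides, the omitted constant states never occur, so both
complete Fourier families of the faces are available. -/
theorem VanishesOffDiag.eq_zero {a b c n : ℕ} (ha : 2 * n + 3 ≤ a) (hb : 2 * n + 3 ≤ b)
    (hc : 2 * n + 3 ≤ c) {E : Fin b × Fin c → Fin b × Fin c → ℂ}
    (hE : VanishesOffDiag (setU a b c n) E)
    {k k' : Option (Fin (n + 1) × Fin 6)} (hk : k ≠ k')
    (h1 : 1 < (box a b c n k).p) (h1' : 1 < (box a b c n k').p)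
    (hov : ∑ x, conj (four a (box a b c n k).x (box a b c n k).p 1 x) *
      four a (box a b c n k').x (box a b c n k').p 1 x ≠ 0)
    {p q : Fin b × Fin c} (hp : p ∈ (box a b c n k).faceDom b c)
    (hq : q ∈ (box a b c n k').faceDom b c) : E p q = 0 := by
  refine (box_valid ha hb hc k).fourierOn_face.star_eq_zero (fun p => E p q) (fun s hs => ?_) hp
  refine (box_valid ha hb hc k').fourierOn_face.eq_zero
    (fun q => ∑ p, conj ((box a b c n k).face b c s p) * E p q) (fun s' hs' => ?_) hq
  rw [← hE.face ha hb hc h1 hs h1' hs' (by simp) (by simp) (fun h => absurd h hk) hov,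
    Finset.sum_comm]
  exact Finset.sum_congr rfl fun q _ => Finset.sum_mul ..

/-- Meant for a box `k'` of thickness one: its only first-party index is 0, so the constant face
function is missing and only constancy in `q` survives. -/
theorem VanishesOffDiag.eq_of_mem {a b c n : ℕ} (ha : 2 * n + 3 ≤ a) (hb : 2 * n + 3 ≤ b)
    (hc : 2 * n + 3 ≤ c) {E : Fin b × Fin c → Fin b × Fin c → ℂ}
    (hE : VanishesOffDiag (setU a b c n) E)
    {k k' : Option (Fin (n + 1) × Fin 6)} (hk : k ≠ k')
    (h1 : 1 < (box a b c n k).p)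
    (hov : ∑ x, conj (four a (box a b c n k).x (box a b c n k).p 1 x) *
      four a (box a b c n k').x (box a b c n k').p 0 x ≠ 0)
    {p q q' : Fin b × Fin c} (hp : p ∈ (box a b c n k).faceDom b c)
    (hq : q ∈ (box a b c n k').faceDom b c) (hq' : q' ∈ (box a b c n k').faceDom b c) :
    E p q = E p q' := by
  rw [← sub_eq_zero]
  refine (box_valid ha hb hc k).fourierOn_face.star_eq_zero (fun p => E p q - E p q')
    (fun s hs => ?_) hp
  simp_rw [mul_sub]
  rw [Finset.sum_sub_distrib, sub_eq_zero]
  refine (box_valid ha hb hc k').fourierOn_face.eq_of_mem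
    (fun q => ∑ p, conj ((box a b c n k).face b c s p) * E p q) (fun s' hs' h0 => ?_) hq hq'
  rw [← hE.face ha hb hc h1 hs (Nat.pos_of_ne_zero (box_valid ha hb hc k').p_ne) hs' (by simp)
    (by simpa using h0) (fun h => absurd h hk) hov, Finset.sum_comm]
  exact Finset.sum_congr rfl fun q _ => Finset.sum_mul ..

/-- Pairing with the stopper, which is 1 everywhere, turns the form into column sums. First-party
index 0 gives the nonzero overlap `p`. -/
theorem VanishesOffDiag.col_sum_eq {a b c n : ℕ} (ha : 2 * n + 3 ≤ a) (hb : 2 * n + 3 ≤ b)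
    (hc : 2 * n + 3 ≤ c) {E : Fin b × Fin c → Fin b × Fin c → ℂ}
    (hE : VanishesOffDiag (setU a b c n) E)
    (k : Option (Fin (n + 1) × Fin 6))
    {q q' : Fin b × Fin c} (hq : q ∈ (box a b c n k).faceDom b c)
    (hq' : q' ∈ (box a b c n k).faceDom b c) : ∑ p, E p q = ∑ p, E p q' := by
  have hv := box_valid ha hb hc k
  refine hv.fourierOn_face.eq_of_mem (fun q => ∑ p, E p q) (fun s hs h0 => ?_) hq hq'
  have hm : (0, s) ∈ (box a b c n k).idx :=
    Finset.mem_product.2 ⟨Finset.mem_range.2 (Nat.pos_of_ne_zero hv.p_ne), hs⟩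
  have h0' : ((0, s) : ℕ × ℕ × ℕ) ≠ 0 := by simpa using h0
  have := hE _ (mem_setU_iff.2 (.inr rfl)) _ (mem_setU_iff.2 (.inl ⟨k, _, hm, h0', rfl⟩))
    fun h => by
      have h1 := hv.inner_stopper_vec hm h0'
      rw [← h, inner_self_eq_zero] at h1
      exact stopper_ne_zero (by omega) (by omega) (by omega) h1
  simp_rw [stopper_apply, Box.vec_apply] at this
  have h2 := (sum_prod_form (fun _ => 1) (four a (box a b c n k).x (box a b c n k).p 0)
    (fun _ => 1) ((box a b c n k).face b c s) E).symm.trans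
    (Eq.trans (by simp [Box.face]) this)
  have h3 := (fourierOn_four hv.p_ne hv.x_le).sum_eq
    (Finset.mem_range.2 (Nat.pos_of_ne_zero hv.p_ne))
  simp only [map_one, one_mul] at h2
  rw [h3, if_pos rfl] at h2
  rw [← (mul_eq_zero.1 h2).resolve_left (by exact_mod_cast hv.p_ne), Finset.sum_comm]
  exact Finset.sum_congr rfl fun q _ => Finset.sum_mul ..

theorem VanishesOffDiag.diag {a b c n : ℕ} (ha : 2 * n + 3 ≤ a) (hb : 2 * n + 3 ≤ b)
    (hc : 2 * n + 3 ≤ c) {E : Fin b × Fin c → Fin b × Fin c → ℂ}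
    (hE : VanishesOffDiag (setU a b c n) E)
    (k : Option (Fin (n + 1) × Fin 6)) :
    ∀ s ∈ (box a b c n k).faceIdx, ∀ s' ∈ (box a b c n k).faceIdx, s ≠ 0 → s' ≠ 0 → s ≠ s' →
      ∑ p, ∑ q, conj ((box a b c n k).face b c s p) * E p q * (box a b c n k).face b c s' q
        = 0 := by
  intro s hs s' hs' h0 h0' hss
  have hv := box_valid ha hb hc k
  have hp := Nat.pos_of_ne_zero hv.p_ne
  refine hE.face ha hb hc hp hs hp hs' (by simpa using h0) (by simpa using h0')
    (fun _ h => hss (Prod.ext_iff.1 h).2) ?_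
  have := (fourierOn_four hv.p_ne hv.x_le).orth 0 (Finset.mem_range.2 hp) 0 (Finset.mem_range.2 hp)
  rw [this, if_pos rfl]
  exact_mod_cast hv.p_ne

theorem overlap_self {a x m : ℕ} (hm : 1 < m) (h : x + m ≤ a) :
    ∑ i, conj (four a x m 1 i) * four a x m 1 i ≠ 0 := by
  rw [(fourierOn_four (by omega) h).orth 1 (Finset.mem_range.2 hm) 1 (Finset.mem_range.2 hm),
    if_pos rfl]
  exact_mod_cast (by omega : m ≠ 0)

/-- On the common part of the two intervals every term equals `w m`, so nothing cancels. -/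
theorem overlap_succ {a x m : ℕ} (hm : 1 < m) (h : x + 1 + m ≤ a) :
    ∑ i, conj (four a (x + 1) m 1 i) * four a x m 1 i ≠ 0 := by
  have h1 : ∀ i : Fin a, conj (four a (x + 1) m 1 i) * four a x m 1 i
      = if x + 1 ≤ i ∧ (i : ℕ) < x + m then w m else 0 := by
    intro i
    rw [four_apply, four_apply]
    by_cases h1 : x + 1 ≤ i ∧ (i : ℕ) < x + m
    · rw [if_pos h1, if_pos (by omega), if_pos (by omega), one_mul, one_mul,
        show (i : ℕ) - x = i - (x + 1) + 1 by omega, pow_succ, ← mul_assoc, map_pow, ← mul_pow,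
        mul_comm (conj _), w_mul_conj (by omega), one_pow, one_mul]
    · rw [if_neg h1]
      by_cases h2 : x + 1 ≤ (i : ℕ)
      · rw [if_neg (c := x ≤ (i : ℕ) ∧ _) (by omega), mul_zero]
      · rw [if_neg (c := x + 1 ≤ (i : ℕ) ∧ _) (by omega), map_zero, zero_mul]
  simp_rw [h1]
  rw [← Finset.sum_filter, Finset.sum_const, nsmul_eq_mul]
  refine mul_ne_zero ?_ ((w_isPrimitiveRoot (by omega)).ne_zero (by omega))
  rw [Nat.cast_ne_zero, Finset.card_ne_zero]
  exact ⟨⟨x + 1, by omega⟩, by simp; omega⟩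

theorem overlap_ket {a x m y : ℕ} (hm : 1 < m) (h : x + m ≤ a) (hy : x ≤ y ∧ y < x + m) :
    ∑ i, conj (four a x m 1 i) * four a y 1 0 i ≠ 0 := by
  rw [← ket_eq_four, Finset.sum_eq_single ⟨y, by omega⟩]
  · rw [ket_apply, if_pos rfl, mul_one, four_apply, if_pos (by exact hy), map_pow]
    refine pow_ne_zero _ ?_
    rw [Ne, map_eq_zero]
    exact (w_isPrimitiveRoot (by omega)).ne_zero (by omega)
  · intro i _ hi
    rw [ket_apply, if_neg (fun hh => hi (Fin.ext hh)), mul_zero]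
  · simp

theorem VanishesOffDiag.trivial {a b c n : ℕ} (ha : 2 * n + 3 ≤ a) (hb : 2 * n + 3 ≤ b)
    (hc : 2 * n + 3 ≤ c) {E : Fin b × Fin c → Fin b × Fin c → ℂ}
    (hE : VanishesOffDiag (setU a b c n) E) (hherm : ∀ p q, conj (E p q) = E q p) :
    ∃ κ : ℂ, ∀ p q, E p q = if p = q then κ else 0 := by
  have hsymm : ∀ p q, E p q = 0 → E q p = 0 := fun p q h => by rw [← hherm, h, map_zero]
  -- Only the outermost shell is needed. Projected to the last two parties, A₁, A₂, B₁, B₂ become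
  -- border lines of the grid, while A₃ and B₃ become the wide rectangles.
  let K : Fin 6 → Option (Fin (n + 1) × Fin 6) := fun e => some (0, e)
  have hK : ∀ e e', e ≠ e' → K e ≠ K e' := by intro e e' h h'; simp [K] at h'; exact h h'
  have hdom : ∀ e p, p ∈ (box a b c n (K e)).faceDom b c ↔ p ∈ (shellBox a b c 0 e).faceDom b c :=
    fun _ _ => Iff.rfl
  have ho : 1 < a - 2 * 0 - 1 := by omega
  have ho' : 0 + 1 + (a - 2 * 0 - 1) ≤ a := by omega
  have ho'' : 0 + (a - 2 * 0 - 1) ≤ a := by omega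
  have hoA : 0 + 1 ≤ a - 1 - 0 ∧ a - 1 - 0 < 0 + 1 + (a - 2 * 0 - 1) := by omega
  have hoB : 0 ≤ 0 ∧ 0 < 0 + (a - 2 * 0 - 1) := by omega
  have hA1A2 : ∀ p q : Fin b × Fin c, (p.1 : ℕ) = 0 → (p.2 : ℕ) ≠ c - 1 → (q.1 : ℕ) ≠ b - 1 →
      (q.2 : ℕ) = c - 1 → E p q = 0 := fun p q h1 h2 h3 h4 =>
    hE.eq_zero ha hb hc (hK 0 1 (by decide)) ho ho (overlap_self ho ho')
      (by rw [hdom, Box.mem_faceDom]; simp only [shellBox]; omega)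
      (by rw [hdom, Box.mem_faceDom]; simp only [shellBox]; omega)
  have hA1B2 : ∀ p q : Fin b × Fin c, (p.1 : ℕ) = 0 → (p.2 : ℕ) ≠ c - 1 → (q.1 : ℕ) ≠ 0 →
      (q.2 : ℕ) = 0 → E p q = 0 := fun p q h1 h2 h3 h4 =>
    hE.eq_zero ha hb hc (hK 0 4 (by decide)) ho ho (overlap_succ ho ho')
      (by rw [hdom, Box.mem_faceDom]; simp only [shellBox]; omega)
      (by rw [hdom, Box.mem_faceDom]; simp only [shellBox]; omega)
  have hA1B1 : ∀ p q : Fin b × Fin c, (p.1 : ℕ) = 0 → (p.2 : ℕ) ≠ c - 1 → (q.1 : ℕ) = b - 1 →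
      (q.2 : ℕ) ≠ 0 → E p q = 0 := fun p q h1 h2 h3 h4 =>
    hE.eq_zero ha hb hc (hK 0 3 (by decide)) ho ho (overlap_succ ho ho')
      (by rw [hdom, Box.mem_faceDom]; simp only [shellBox]; omega)
      (by rw [hdom, Box.mem_faceDom]; simp only [shellBox]; omega)
  have hA2B1 : ∀ p q : Fin b × Fin c, (p.1 : ℕ) ≠ b - 1 → (p.2 : ℕ) = c - 1 → (q.1 : ℕ) = b - 1 →
      (q.2 : ℕ) ≠ 0 → E p q = 0 := fun p q h1 h2 h3 h4 =>
    hE.eq_zero ha hb hc (hK 1 3 (by decide)) ho ho (overlap_succ ho ho')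
      (by rw [hdom, Box.mem_faceDom]; simp only [shellBox]; omega)
      (by rw [hdom, Box.mem_faceDom]; simp only [shellBox]; omega)
  have hA2B2 : ∀ p q : Fin b × Fin c, (p.1 : ℕ) ≠ b - 1 → (p.2 : ℕ) = c - 1 → (q.1 : ℕ) ≠ 0 →
      (q.2 : ℕ) = 0 → E p q = 0 := fun p q h1 h2 h3 h4 =>
    hE.eq_zero ha hb hc (hK 1 4 (by decide)) ho ho (overlap_succ ho ho')
      (by rw [hdom, Box.mem_faceDom]; simp only [shellBox]; omega)
      (by rw [hdom, Box.mem_faceDom]; simp only [shellBox]; omega)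
  have hB1B2 : ∀ p q : Fin b × Fin c, (p.1 : ℕ) = b - 1 → (p.2 : ℕ) ≠ 0 → (q.1 : ℕ) ≠ 0 →
      (q.2 : ℕ) = 0 → E p q = 0 := fun p q h1 h2 h3 h4 =>
    hE.eq_zero ha hb hc (hK 3 4 (by decide)) ho ho (overlap_self ho ho'')
      (by rw [hdom, Box.mem_faceDom]; simp only [shellBox]; omega)
      (by rw [hdom, Box.mem_faceDom]; simp only [shellBox]; omega)
  -- `ll` and `hh` are the two grid points outside both rectangles. `hl` lies in A₃ and B₂, `lh` in
  -- B₃ and A₂, so each is a point of a rectangle at which vanishing is already known. `mm` lies in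
  -- both rectangles.
  let ll : Fin b × Fin c := (⟨0, by omega⟩, ⟨0, by omega⟩)
  let hh : Fin b × Fin c := (⟨b - 1, by omega⟩, ⟨c - 1, by omega⟩)
  let lh : Fin b × Fin c := (⟨0, by omega⟩, ⟨c - 1, by omega⟩)
  let hl : Fin b × Fin c := (⟨b - 1, by omega⟩, ⟨0, by omega⟩)
  let mm : Fin b × Fin c := (⟨1, by omega⟩, ⟨1, by omega⟩)
  -- For `p` in A₁ or A₂ the entry is constant in `q` along A₃, and it vanishes at `hl`, which also
  -- lies in B₂.
  have hA_in : ∀ p q : Fin b × Fin c, ((p.1 : ℕ) = 0 ∨ (p.2 : ℕ) = c - 1) → p ≠ hh →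
      (q.1 : ℕ) ≠ 0 → (q.2 : ℕ) ≠ c - 1 → E p q = 0 := by
    intro p q h1 h2 h3 h4
    have h2' : ¬ ((p.1 : ℕ) = b - 1 ∧ (p.2 : ℕ) = c - 1) := fun h =>
      h2 (Prod.ext (Fin.ext h.1) (Fin.ext h.2))
    by_cases h5 : (p.2 : ℕ) = c - 1
    · rw [hE.eq_of_mem ha hb hc (k := K 1) (k' := K 2) (hK 1 2 (by decide)) ho
        (overlap_ket ho ho' hoA) (q' := hl)
        (by rw [hdom, Box.mem_faceDom]; simp only [shellBox]; omega)
        (by rw [hdom, Box.mem_faceDom]; simp only [shellBox]; omega)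
        (by rw [hdom, Box.mem_faceDom]; simp only [shellBox, hl]; omega)]
      exact hA2B2 p hl (by omega) h5 (by simp only [hl]; omega) rfl
    · rw [hE.eq_of_mem ha hb hc (k := K 0) (k' := K 2) (hK 0 2 (by decide)) ho
        (overlap_ket ho ho' hoA) (q' := hl)
        (by rw [hdom, Box.mem_faceDom]; simp only [shellBox]; omega)
        (by rw [hdom, Box.mem_faceDom]; simp only [shellBox]; omega)
        (by rw [hdom, Box.mem_faceDom]; simp only [shellBox, hl]; omega)]
      exact hA1B2 p hl (by omega) h5 (by simp only [hl]; omega) rfl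
  have hB_in : ∀ p q : Fin b × Fin c, ((p.1 : ℕ) = b - 1 ∨ (p.2 : ℕ) = 0) → p ≠ ll →
      (q.1 : ℕ) ≠ b - 1 → (q.2 : ℕ) ≠ 0 → E p q = 0 := by
    intro p q h1 h2 h3 h4
    have h2' : ¬ ((p.1 : ℕ) = 0 ∧ (p.2 : ℕ) = 0) := fun h =>
      h2 (Prod.ext (Fin.ext h.1) (Fin.ext h.2))
    by_cases h5 : (p.2 : ℕ) = 0
    · rw [hE.eq_of_mem ha hb hc (k := K 4) (k' := K 5) (hK 4 5 (by decide)) ho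
        (overlap_ket ho ho'' hoB) (q' := lh)
        (by rw [hdom, Box.mem_faceDom]; simp only [shellBox]; omega)
        (by rw [hdom, Box.mem_faceDom]; simp only [shellBox]; omega)
        (by rw [hdom, Box.mem_faceDom]; simp only [shellBox, lh]; omega)]
      exact hsymm _ _ (hA2B2 lh p (by simp only [lh]; omega) rfl (by omega) h5)
    · rw [hE.eq_of_mem ha hb hc (k := K 3) (k' := K 5) (hK 3 5 (by decide)) ho
        (overlap_ket ho ho'' hoB) (q' := lh)
        (by rw [hdom, Box.mem_faceDom]; simp only [shellBox]; omega)
        (by rw [hdom, Box.mem_faceDom]; simp only [shellBox]; omega)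
        (by rw [hdom, Box.mem_faceDom]; simp only [shellBox, lh]; omega)]
      exact hsymm _ _ (hA2B1 lh p (by simp only [lh]; omega) rfl (by omega) h5)
  have hsumD : ∀ q : Fin b × Fin c, ((q.1 : ℕ) ≠ b - 1 ∧ (q.2 : ℕ) ≠ 0) ∨
      ((q.1 : ℕ) ≠ 0 ∧ (q.2 : ℕ) ≠ c - 1) → ∑ p, E p q = ∑ p, E p mm := by
    rintro q (h | h)
    · exact hE.col_sum_eq ha hb hc (K 5)
        (by rw [hdom, Box.mem_faceDom]; simp only [shellBox]; omega)
        (by rw [hdom, Box.mem_faceDom]; simp only [shellBox, mm]; omega)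
    · exact hE.col_sum_eq ha hb hc (K 2)
        (by rw [hdom, Box.mem_faceDom]; simp only [shellBox]; omega)
        (by rw [hdom, Box.mem_faceDom]; simp only [shellBox, mm]; omega)
  have hsum : ∀ q, ∑ p, E p q = ∑ p, E p mm := by
    intro q
    by_cases h1 : ((q.1 : ℕ) ≠ b - 1 ∧ (q.2 : ℕ) ≠ 0) ∨ ((q.1 : ℕ) ≠ 0 ∧ (q.2 : ℕ) ≠ c - 1)
    · exact hsumD q h1
    by_cases h2 : (q.1 : ℕ) = 0
    · rw [hE.col_sum_eq ha hb hc (K 0) (q := q) (q' := (⟨0, by omega⟩, ⟨1, by omega⟩))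
        (by rw [hdom, Box.mem_faceDom]; simp only [shellBox]; omega)
        (by rw [hdom, Box.mem_faceDom]; simp only [shellBox]; omega)]
      exact hsumD _ (.inl (by simp only; omega))
    · rw [hE.col_sum_eq ha hb hc (K 3) (q := q) (q' := (⟨b - 1, by omega⟩, ⟨1, by omega⟩))
        (by rw [hdom, Box.mem_faceDom]; simp only [shellBox]; omega)
        (by rw [hdom, Box.mem_faceDom]; simp only [shellBox]; omega)]
      exact hsumD _ (.inr (by simp only; omega))
  have hmemB : ∀ p, p ∈ (shellBox a b c 0 5).faceDom b c ↔ (p.1 : ℕ) ≠ b - 1 ∧ (p.2 : ℕ) ≠ 0 := by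
    intro p; rw [Box.mem_faceDom]; simp only [shellBox]; omega
  have hmemA : ∀ p, p ∈ (shellBox a b c 0 2).faceDom b c ↔ (p.1 : ℕ) ≠ 0 ∧ (p.2 : ℕ) ≠ c - 1 := by
    intro p; rw [Box.mem_faceDom]; simp only [shellBox]; omega
  have hvB := box_valid ha hb hc (K 5)
  have hvA := box_valid ha hb hc (K 2)
  -- Inside B₃ the column z = c-1 belongs to A₂ and the rest of the row y = 0 to A₁, while what
  -- remains lies in A₃. The blocks between these parts are already zero.
  obtain ⟨hB, hBo⟩ := hvB.fourierOn_face.offDiag_eq_zero hherm (o := ll)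
    (Col := fun p => p.2 = lh.2) (Row := fun p => p.1 = lh.1)
    (by rw [hdom, hmemB]; simp [ll]) (hE.diag ha hb hc (K 5)) (fun q _ => hsum q)
    (by
      intro p hp hpo q hq
      rw [hdom, hmemB] at hp hq
      exact hB_in p q (by omega) hpo hq.1 hq.2)
    (by
      intro q hq h
      rw [hdom, hmemB] at hq
      simp only [lh, Fin.ext_iff] at h
      by_cases h1 : (q.2 : ℕ) = c - 1
      · exact hA1A2 ll q rfl (by simp only [ll]; omega) (by omega) h1
      · refine hA_in ll q (.inl rfl) ?_ (by omega) h1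
        simp only [ll, hh, Ne, Prod.ext_iff, Fin.ext_iff]; omega)
    (by
      intro p hp q hq h1 h2
      rw [hdom, hmemB] at hp hq
      simp only [lh, Fin.ext_iff] at h1 h2
      by_cases h3 : (q.1 : ℕ) = 0
      · exact hsymm _ _ (hA1A2 q p h3 h2 (by omega) h1)
      · refine hA_in p q (.inr h1) ?_ h3 h2
        simp only [hh, Ne, Prod.ext_iff, Fin.ext_iff]; omega)
    (by
      intro p hp q hq h1 h2 h3 h4
      rw [hdom, hmemB] at hp hq
      simp only [lh, Fin.ext_iff] at h1 h2 h3 h4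
      refine hA_in p q (.inl h3) ?_ h4 h2
      simp only [hh, Ne, Prod.ext_iff, Fin.ext_iff]; omega)
    ⟨lh, by rw [hdom, hmemB]; simp only [lh]; omega, rfl⟩
    (exists_shift_rect hvB.y_le hvB.z_le (u := lh.1) (u' := mm.1) (v := lh.2) (v' := mm.2)
      (by simp only [K, box, shellBox, Fin.val_zero, ival, Set.mem_ofPred_eq, lh]; omega)
      (by simp only [K, box, shellBox, Fin.val_zero, ival, Set.mem_ofPred_eq, mm]; omega)
      (by simp [lh, mm])
      (by simp only [K, box, shellBox, Fin.val_zero, ival, Set.mem_ofPred_eq, lh]; omega)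
      (by simp only [K, box, shellBox, Fin.val_zero, ival, Set.mem_ofPred_eq, mm]; omega)
      (by simp only [lh, mm, Ne, Fin.ext_iff]; omega))
  -- The mirror image: inside A₃ the column z = 0 belongs to B₂, the rest of the row y = b-1 to B₁,
  -- and what remains to B₃.
  obtain ⟨hA, hAo⟩ := hvA.fourierOn_face.offDiag_eq_zero hherm (o := hh)
    (Col := fun p => p.2 = hl.2) (Row := fun p => p.1 = hl.1)
    (by rw [hdom, hmemA]; simp [hh]) (hE.diag ha hb hc (K 2)) (fun q _ => hsum q)
    (by
      intro p hp hpo q hq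
      rw [hdom, hmemA] at hp hq
      exact hA_in p q (by omega) hpo hq.1 hq.2)
    (by
      intro q hq h
      rw [hdom, hmemA] at hq
      simp only [hl, Fin.ext_iff] at h
      by_cases h1 : (q.2 : ℕ) = 0
      · exact hB1B2 hh q rfl (by simp only [hh]; omega) (by omega) h1
      · refine hB_in hh q (.inl rfl) ?_ (by omega) h1
        simp only [ll, hh, Ne, Prod.ext_iff, Fin.ext_iff]; omega)
    (by
      intro p hp q hq h1 h2
      rw [hdom, hmemA] at hp hq
      simp only [hl, Fin.ext_iff] at h1 h2
      by_cases h3 : (q.1 : ℕ) = b - 1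
      · exact hsymm _ _ (hB1B2 q p h3 h2 (by omega) h1)
      · refine hB_in p q (.inr h1) ?_ h3 h2
        simp only [ll, Ne, Prod.ext_iff, Fin.ext_iff]; omega)
    (by
      intro p hp q hq h1 h2 h3 h4
      rw [hdom, hmemA] at hp hq
      simp only [hl, Fin.ext_iff] at h1 h2 h3 h4
      refine hB_in p q (.inl h3) ?_ h4 h2
      simp only [ll, Ne, Prod.ext_iff, Fin.ext_iff]; omega)
    ⟨hl, by rw [hdom, hmemA]; simp only [hl]; omega, rfl⟩
    (exists_shift_rect hvA.y_le hvA.z_le (u := hl.1) (u' := mm.1) (v := hl.2) (v' := mm.2)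
      (by simp only [K, box, shellBox, Fin.val_zero, ival, Set.mem_ofPred_eq, hl]; omega)
      (by simp only [K, box, shellBox, Fin.val_zero, ival, Set.mem_ofPred_eq, mm]; omega)
      (by simp only [hl, mm, Ne, Fin.ext_iff]; omega)
      (by simp only [K, box, shellBox, Fin.val_zero, ival, Set.mem_ofPred_eq, hl]; omega)
      (by simp only [K, box, shellBox, Fin.val_zero, ival, Set.mem_ofPred_eq, mm]; omega)
      (by simp [hl, mm]))
  simp only [hdom, hmemA, hmemB] at hA hAo hB hBo
  have hoff : ∀ p q, p ≠ q → E p q = 0 := by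
    have key : ∀ p q : Fin b × Fin c, p ≠ q → ((p.1 : ℕ) ≠ b - 1 ∧ (p.2 : ℕ) ≠ 0) → E p q = 0 := by
      intro p q hpq hp
      by_cases h1 : (q.1 : ℕ) ≠ b - 1 ∧ (q.2 : ℕ) ≠ 0
      · exact hB p hp q h1 hpq
      · by_cases h2 : q = ll
        · rw [h2]; exact hsymm _ _ (hBo p hp)
        · exact hsymm _ _ (hB_in q p (by omega) h2 hp.1 hp.2)
    have key' : ∀ p q : Fin b × Fin c, p ≠ q → ((p.1 : ℕ) ≠ 0 ∧ (p.2 : ℕ) ≠ c - 1) → E p q = 0 := by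
      intro p q hpq hp
      by_cases h1 : (q.1 : ℕ) ≠ 0 ∧ (q.2 : ℕ) ≠ c - 1
      · exact hA p hp q h1 hpq
      · by_cases h2 : q = hh
        · rw [h2]; exact hsymm _ _ (hAo p hp)
        · exact hsymm _ _ (hA_in q p (by omega) h2 hp.1 hp.2)
    have hcorner : ∀ q : Fin b × Fin c, ¬ ((q.1 : ℕ) ≠ b - 1 ∧ (q.2 : ℕ) ≠ 0) →
        ¬ ((q.1 : ℕ) ≠ 0 ∧ (q.2 : ℕ) ≠ c - 1) → q = ll ∨ q = hh := by
      intro q h1 h2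
      simp only [ll, hh, Prod.ext_iff, Fin.ext_iff]; omega
    have hllhh : E ll hh = 0 := by
      refine hA1B1 ll hh rfl ?_ rfl ?_ <;> simp only [ll, hh] <;> omega
    intro p q hpq
    by_cases h1 : (p.1 : ℕ) ≠ b - 1 ∧ (p.2 : ℕ) ≠ 0
    · exact key p q hpq h1
    by_cases h2 : (p.1 : ℕ) ≠ 0 ∧ (p.2 : ℕ) ≠ c - 1
    · exact key' p q hpq h2
    by_cases h3 : (q.1 : ℕ) ≠ b - 1 ∧ (q.2 : ℕ) ≠ 0
    · exact hsymm _ _ (key q p hpq.symm h3)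
    by_cases h4 : (q.1 : ℕ) ≠ 0 ∧ (q.2 : ℕ) ≠ c - 1
    · exact hsymm _ _ (key' q p hpq.symm h4)
    rcases hcorner p h1 h2 with rfl | rfl <;> rcases hcorner q h3 h4 with rfl | rfl
    · exact absurd rfl hpq
    · exact hllhh
    · exact hsymm _ _ hllhh
    · exact absurd rfl hpq
  -- Once the off-diagonal entries vanish, each diagonal entry is its column sum, and these all
  -- agree.
  refine ⟨∑ p, E p mm, fun p q => ?_⟩
  split_ifs with h
  · subst h
    rw [← hsum p, Finset.sum_eq_single p (fun q _ hq => hoff q p hq) (by simp)]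
  · exact hoff p q h

/-! ### Cyclic symmetry -/

/-- The cyclic permutation `x ⊗ y ⊗ z ↦ y ⊗ z ⊗ x` of the parties. -/
def rotate (a b c : ℕ) : Tri a b c ≃ₗᵢ[ℂ] Tri b c a :=
  LinearIsometryEquiv.piLpCongrLeft 2 ℂ ℂ (groupB a b c)

theorem rotate_apply {a b c : ℕ} (ψ : Tri a b c) (P : Fin b × Fin c × Fin a) :
    rotate a b c ψ P = ψ (P.2.2, P.1, P.2.1) := rfl

theorem rotate_triProd {a b c : ℕ} (x : EuclideanSpace ℂ (Fin a)) (y : EuclideanSpace ℂ (Fin b))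
    (z : EuclideanSpace ℂ (Fin c)) : rotate a b c (triProd x y z) = triProd y z x := by
  ext P
  rw [rotate_apply, triProd_apply, triProd_apply]; ring

def Box.rotate (B : Box) : Box := ⟨B.y, B.q, B.z, B.r, B.x, B.p⟩

theorem exists_box_rotate (a b c n : ℕ) (k : Option (Fin (n + 1) × Fin 6)) :
    ∃ k', (box a b c n k).rotate = box b c a n k' := by
  rcases k with _ | ⟨t, e⟩
  · exact ⟨none, rfl⟩
  · fin_cases e
    · exact ⟨some (t, 5), rfl⟩
    · exact ⟨some (t, 3), rfl⟩
    · exact ⟨some (t, 1), rfl⟩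
    · exact ⟨some (t, 2), rfl⟩
    · exact ⟨some (t, 0), rfl⟩
    · exact ⟨some (t, 4), rfl⟩

theorem rotate_mem_setU {a b c n : ℕ} {ψ : Tri a b c} (hψ : ψ ∈ setU a b c n) :
    rotate a b c ψ ∈ setU b c a n := by
  rw [mem_setU_iff] at hψ ⊢
  rcases hψ with ⟨k, s, hs, h0, rfl⟩ | rfl
  · obtain ⟨k', hk'⟩ := exists_box_rotate a b c n k
    refine .inl ⟨k', (s.2.1, s.2.2, s.1), ?_, fun h => h0 ?_, ?_⟩
    · rw [← hk']
      rw [Box.mem_idx] at hs ⊢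
      exact ⟨hs.2.1, hs.2.2, hs.1⟩
    · simp only [Prod.ext_iff, Prod.fst_zero, Prod.snd_zero] at h ⊢
      exact ⟨h.2.2, h.1, h.2.1⟩
    · rw [← hk']; exact (rotate_triProd ..).symm
  · exact .inr (rotate_triProd ..)

theorem rotate_image_setU (a b c n : ℕ) : rotate a b c '' setU a b c n = setU b c a n := by
  -- Three rotations are the identity, so two further rotations give a preimage.
  refine Set.Subset.antisymm ?_ fun φ hφ =>
    ⟨_, rotate_mem_setU (rotate_mem_setU hφ), rfl⟩
  rintro _ ⟨ψ, hψ, rfl⟩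
  exact rotate_mem_setU hψ

/-! ### Local irreducibility -/

section
variable {X Y : Type} [Fintype X] [Fintype Y] [DecidableEq X] [DecidableEq Y]

theorem actOn_apply (K : Matrix (X × Y) (X × Y) ℂ) (ψ : EuclideanSpace ℂ (X × Y)) (P : X × Y) :
    actOn K ψ P = ∑ Q, K P Q * ψ Q := rfl

theorem inner_actOn_actOn (K : Matrix (X × Y) (X × Y) ℂ) (ψ φ : EuclideanSpace ℂ (X × Y)) :
    inner ℂ (actOn K ψ) (actOn K φ) = inner ℂ ψ (actOn (K.conjTranspose * K) φ) := by
  rw [actOn, ← LinearMap.adjoint_inner_right, ← Matrix.toEuclideanLin_conjTranspose_eq_adjoint]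
  simp [actOn, Matrix.toLpLin_apply]

theorem actOn_smul (κ : ℂ) (K : Matrix (X × Y) (X × Y) ℂ) (ψ : EuclideanSpace ℂ (X × Y)) :
    actOn (κ • K) ψ = κ • actOn K ψ := by
  simp [actOn]

theorem actOn_one (ψ : EuclideanSpace ℂ (X × Y)) : actOn 1 ψ = ψ := by
  simp [actOn]

theorem inner_actOn_one_kronecker (E : Matrix Y Y ℂ) (ψ φ : EuclideanSpace ℂ (X × Y)) :
    inner ℂ ψ (actOn ((1 : Matrix X X ℂ) ⊗ₖ E) φ)
      = ∑ x, ∑ p, ∑ q, conj (ψ (x, p)) * E p q * φ (x, q) := by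
  simp only [PiLp.inner_apply, RCLike.inner_apply, actOn_apply, Fintype.sum_prod_type,
    Matrix.kroneckerMap_apply, Matrix.one_apply]
  refine Finset.sum_congr rfl fun x _ => Finset.sum_congr rfl fun p _ => ?_
  rw [Finset.sum_eq_single x (fun x' _ hx => by simp [hx.symm]) (by simp), Finset.sum_mul]
  exact Finset.sum_congr rfl fun q _ => by simp; ring

theorem inner_actOn_kronecker_one (E : Matrix X X ℂ) (ψ φ : EuclideanSpace ℂ (X × Y)) :
    inner ℂ ψ (actOn (E ⊗ₖ (1 : Matrix Y Y ℂ)) φ)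
      = ∑ y, ∑ p, ∑ q, conj (ψ (p, y)) * E p q * φ (q, y) := by
  simp only [PiLp.inner_apply, RCLike.inner_apply, actOn_apply, Fintype.sum_prod_type,
    Matrix.kroneckerMap_apply, Matrix.one_apply]
  rw [Finset.sum_comm]
  refine Finset.sum_congr rfl fun y _ => Finset.sum_congr rfl fun p _ => ?_
  rw [Finset.sum_mul]
  refine Finset.sum_congr rfl fun q _ => ?_
  rw [Finset.sum_eq_single y (fun x' _ hx => by simp [hx.symm]) (by simp)]
  simp; ring

open scoped ComplexOrder in
/-- If every orthogonality-preserving POVM element of either party is trivial, no state can be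
eliminated. -/
theorem locallyIrreducible_of_trivial {U : Set (EuclideanSpace ℂ (X × Y))} (h0 : ∀ ψ ∈ U, ψ ≠ 0)
    (hX : ∀ E : Matrix X X ℂ, E.IsHermitian →
      (U.Pairwise fun ψ φ => inner ℂ ψ (actOn (E ⊗ₖ (1 : Matrix Y Y ℂ)) φ) = 0) →
      ∃ κ : ℂ, E = κ • 1)
    (hY : ∀ E : Matrix Y Y ℂ, E.IsHermitian →
      (U.Pairwise fun ψ φ => inner ℂ ψ (actOn ((1 : Matrix X X ℂ) ⊗ₖ E) φ) = 0) →
      ∃ κ : ℂ, E = κ • 1) : LocallyIrreducible U := by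
  -- The invariant along a branch: a product of two scaled isometries. When one party measures, the
  -- other's Gram matrix is a nonzero scalar and cancels, so the accumulated operator of the
  -- measuring party satisfies `hX` or `hY`.
  have key : ∀ K, Reachable U K → ∃ (P : Matrix X X ℂ) (Q : Matrix Y Y ℂ) (κ μ : ℂ),
      K = P ⊗ₖ Q ∧ P.conjTranspose * P = κ • 1 ∧ Q.conjTranspose * Q = μ • 1 := by
    intro K hK
    induction hK with
    | start => exact ⟨1, 1, 1, 1, by simp, by simp, by simp⟩
    | @measure K _ r L hL hU k ih =>
      obtain ⟨P, Q, κ, μ, rfl, hP, hQ⟩ := ih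
      by_cases hκμ : κ = 0 ∨ μ = 0
      · refine ⟨0, 0, 0, 0, ?_, by simp, by simp⟩
        have : P ⊗ₖ Q = 0 := by
          rcases hκμ with rfl | rfl
          · rw [zero_smul, Matrix.conjTranspose_mul_self_eq_zero] at hP
            rw [hP, Matrix.zero_kronecker]
          · rw [zero_smul, Matrix.conjTranspose_mul_self_eq_zero] at hQ
            rw [hQ, Matrix.kronecker_zero]
        rw [this, mul_zero, Matrix.zero_kronecker]
      · push Not at hκμ
        rcases hL with ⟨M, -, hM⟩ | ⟨M, -, hM⟩
        · have hLK : L k * P ⊗ₖ Q = (M k * P) ⊗ₖ Q := by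
            rw [hM, ← Matrix.mul_kronecker_mul, one_mul]
          obtain ⟨κ', hκ'⟩ := hX ((M k * P).conjTranspose * (M k * P))
            (Matrix.isHermitian_conjTranspose_mul_self _) (by
              intro ψ hψ φ hφ hne
              have := hU k hψ hφ hne
              rw [hLK, inner_actOn_actOn, Matrix.conjTranspose_kronecker,
                ← Matrix.mul_kronecker_mul, hQ, Matrix.kronecker_smul, actOn_smul,
                inner_smul_right] at this
              exact (mul_eq_zero.1 this).resolve_left hκμ.2)
          exact ⟨M k * P, Q, κ', μ, hLK, hκ', hQ⟩
        · have hLK : L k * P ⊗ₖ Q = P ⊗ₖ (M k * Q) := by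
            rw [hM, ← Matrix.mul_kronecker_mul, one_mul]
          obtain ⟨μ', hμ'⟩ := hY ((M k * Q).conjTranspose * (M k * Q))
            (Matrix.isHermitian_conjTranspose_mul_self _) (by
              intro ψ hψ φ hφ hne
              have := hU k hψ hφ hne
              rw [hLK, inner_actOn_actOn, Matrix.conjTranspose_kronecker,
                ← Matrix.mul_kronecker_mul, hP, Matrix.smul_kronecker, actOn_smul,
                inner_smul_right] at this
              exact (mul_eq_zero.1 this).resolve_left hκμ.1)
          exact ⟨P, M k * Q, κ, μ', hLK, hP, hμ'⟩
  rintro K hK ⟨φ, -, hφ⟩ ψ hψ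
  obtain ⟨P, Q, κ, μ, rfl, hP, hQ⟩ := key K hK
  have hnorm : ∀ χ : EuclideanSpace ℂ (X × Y),
      inner ℂ (actOn (P ⊗ₖ Q) χ) (actOn (P ⊗ₖ Q) χ) = κ * μ * inner ℂ χ χ := by
    intro χ
    rw [inner_actOn_actOn, Matrix.conjTranspose_kronecker, ← Matrix.mul_kronecker_mul, hP, hQ,
      Matrix.smul_kronecker, Matrix.kronecker_smul, Matrix.one_kronecker_one, smul_smul,
      actOn_smul, actOn_one, inner_smul_right]
  have hne : κ * μ ≠ 0 := by
    intro h
    have := hnorm φ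
    rw [h, zero_mul, inner_self_eq_zero] at this
    exact hφ this
  intro h
  have := hnorm ψ
  rw [h, inner_zero_left, eq_comm, mul_eq_zero, inner_self_eq_zero] at this
  exact this.elim hne (h0 ψ hψ)

end

theorem locallyIrreducible_setU {a b c n : ℕ} (ha : 2 * n + 3 ≤ a) (hb : 2 * n + 3 ≤ b)
    (hc : 2 * n + 3 ≤ c) : LocallyIrreducible (setU a b c n) := by
  refine locallyIrreducible_of_trivial (fun ψ hψ => ((isOPS_setU ha hb hc).1 ψ hψ).1) ?_ ?_
  · intro E hE hU
    -- The operator of the first party is viewed as E ⊗ 1 on the first two parties, with the third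
    -- party moved to the front.
    have hV : VanishesOffDiag (setU c a b n)
        fun p q : Fin a × Fin b => (E ⊗ₖ (1 : Matrix (Fin b) (Fin b) ℂ)) p q := by
      intro ψ' hψ' φ' hφ' hne
      rw [← rotate_image_setU b c a, ← rotate_image_setU a b c] at hψ' hφ'
      obtain ⟨_, ⟨ψ, hψ, rfl⟩, rfl⟩ := hψ'
      obtain ⟨_, ⟨φ, hφ, rfl⟩, rfl⟩ := hφ'
      have : inner ℂ ψ (actOn (E ⊗ₖ (1 : Matrix (Fin b × Fin c) (Fin b × Fin c) ℂ)) φ) = 0 :=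
        hU hψ hφ fun h => hne (by rw [h])
      rw [inner_actOn_kronecker_one, Fintype.sum_prod_type, Finset.sum_comm] at this
      rw [← this]
      refine Finset.sum_congr rfl fun k _ => ?_
      rw [Fintype.sum_prod_type, Finset.sum_comm]
      refine Finset.sum_congr rfl fun j _ => Finset.sum_congr rfl fun i _ => ?_
      rw [Fintype.sum_prod_type]
      refine Finset.sum_congr rfl fun i' _ => ?_
      rw [Finset.sum_eq_single j (fun j' _ hj => by simp [hj.symm]) (by simp)]
      simp [rotate_apply]
    obtain ⟨κ, hκ⟩ := hV.trivial hc ha hb fun p q => by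
      have h1 : conj (E p.1 q.1) = E q.1 p.1 := hE.apply q.1 p.1
      simp [Matrix.kroneckerMap_apply, h1, Matrix.one_apply, apply_ite conj, eq_comm]
    refine ⟨κ, Matrix.ext fun i i' => ?_⟩
    have := hκ (i, ⟨0, by omega⟩) (i', ⟨0, by omega⟩)
    simpa [Matrix.one_apply] using this
  · intro E hE hU
    have hV : VanishesOffDiag (setU a b c n) E := by
      intro ψ hψ φ hφ hne
      rw [← inner_actOn_one_kronecker]
      exact hU hψ hφ hne
    obtain ⟨κ, hκ⟩ := hV.trivial ha hb hc fun p q => hE.apply q p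
    refine ⟨κ, Matrix.ext fun p q => ?_⟩
    rw [hκ]
    simp [Matrix.one_apply]

theorem stronglyNonlocal_setU {a b c n : ℕ} (ha : 2 * n + 3 ≤ a) (hb : 2 * n + 3 ≤ b)
    (hc : 2 * n + 3 ≤ c) : StronglyNonlocal (setU a b c n) := by
  refine ⟨isOPS_setU ha hb hc, locallyIrreducible_setU ha hb hc, ?_, ?_⟩
  · have := locallyIrreducible_setU hb hc ha
    rw [← rotate_image_setU] at this
    exact this
  · have := locallyIrreducible_setU hc ha hb
    rw [← rotate_image_setU b c a, ← rotate_image_setU a b c, Set.image_image] at this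
    exact this

end

theorem theorem1 (dA dB dC n : ℕ) (hA : 3 ≤ dA) (hAB : dA ≤ dB) (hBC : dB ≤ dC)
    (hn : n ≤ (dA - 3) / 2) :
    IsUPB (setU dA dB dC n) ∧
    ((setU dA dB dC n).ncard : ℤ) = (dA : ℤ) * dB * dC - 8 * (n + 1) ∧
    StronglyNonlocal (setU dA dB dC n) := by
  have ha : 2 * n + 3 ≤ dA := by omega
  have hb : 2 * n + 3 ≤ dB := by omega
  have hc : 2 * n + 3 ≤ dC := by omega
  exact ⟨isUPB_setU ha hb hc, ncard_setU ha hb hc, stronglyNonlocal_setU ha hb hc⟩
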